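/- **Setting.** Let $P_{X,S}$ be a probability law on $\mathbb{R}^p\times\mathcal S$, where $\mathcal S$ is a standard Borel space, let $\mathcal Y\subseteq\mathbb{R}^q$ be a Borel set, and let $d:\mathcal S\times\mathcal Y\to[0,\infty]$ be measurable. Put $\bar d(x,y)=E[d(S,y)\mid X=x]$ (through a regular conditional law of $S$ given $X$) and $$R(D)=\inf\{\,I(X;Y): P_{Y|X}\text{ a conditional law on }\mathcal Y,\ E[\bar d(X,Y)]\le D\,\}.$$ Fix $\lambda\ge 0$ and let $P^*_{Y|X}$ be a minimizer of $I(X;Y)+\lambda E[\bar d(X,Y)]$ over all $P_{Y|X}$, with finite minimum. Let $Y^*$ be the corresponding reproduction, $Q^*$ its law, and $D=D_\lambda=E[\bar d(X,Y^*)]$. Let $P_Z$ be a non-atomic probability law on $\mathbb{R}^l$, and let $\sigma:\mathbb{R}\to\mathbb{R}$ be continuous and nondecreasing with limits $0$ at $-\infty$ and $1$ at $+\infty$. For $\theta,\hat\theta\in\mathbb{R}^k$ let $T_\theta:\mathbb{R}^l\to\mathbb{R}^q$ and $g_{\hat\theta}:\mathbb{R}^p\times\mathbb{R}^q\to\mathbb{R}$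 be the feed-forward networks with one hidden layer and activation $\sigma$, i.e. $v\mapsto\sum_h c_h\,\sigma(\langle a_h,v\rangle+b_h)$, with as many hidden units as $k$ parameters allow. For samples $(x_i,s_i)_{i\le n}$ and $(z_j)_{j\le m}$ put $g_{ij}=g_{\hat\theta}(x_i,T_\theta(z_j))$ and $$\widehat{\mathcal L}=-\frac1n\sum_{i=1}^n\log\Big(\frac1m\sum_{j=1}^m e^{-\lambda g_{ij}}\Big),\qquad \widehat D=\frac1n\sum_{i=1}^n\sum_{j=1}^m g_{ij}\,\frac{e^{-\lambda g_{ij}}}{\sum_{j'=1}^m e^{-\lambda g_{ij'}}},\qquad \widehat R(D)=\widehat{\mathcal L}-\lambda\widehat D .$$ **Theorem (strong consistency of NEIRD).** $R(D)$ is finite, and for every $\epsilon>0$ and all sufficiently large $k$ there are compact sets $\Theta,\hat\Theta\subset\mathbb{R}^k$ and parameters $\theta\in\Theta$, $\hat\theta\in\hat\Theta$ such that 1. the law of $T_\theta(Z)$, $Z\sim P_Z$, is within $\epsilon$ of $Q^*$ in the Lévy–Prokhorov distance (for the sup norm on $\mathbb{R}^q$); 2. $g_{\hat\theta}$ approximates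 $\bar d$ in measure: outside a set of $P_X\otimes Q^*$-measure at most $\epsilon$, one has $|g_{\hat\theta}(x,y)-\bar d(x,y)|\le\epsilon$ where $\bar d(x,y)<\infty$, and $g_{\hat\theta}(x,y)\ge 1/\epsilon$ where $\bar d(x,y)=\infty$; 3. for all i.i.d. sequences $(x_i,s_i)_{i\ge1}$ with law $P_{X,S}$ and $(z_j)_{j\ge1}$ with law $P_Z$ on a common probability space, almost surely there are $N$ and $M$ such that $|\widehat R(D)-R(D)|\le\epsilon$ for all $n\ge N$ and $m\ge M$. -/

import Mathlib

open MeasureTheory ProbabilityTheory Filter Topology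
open scoped ENNReal

namespace IndirectRD

noncomputable section

/-! ### The indirect rate-distortion function -/

/-- Reduced distortion measure: `P` is the joint law of the pair (observation `X`, source `S`),
and `dbar P d x y` is the conditional expectation of `d (S, y)` given `X = x`. -/
def dbar {p : ℕ} {S Y : Type*} [MeasurableSpace S] [StandardBorelSpace S] [Nonempty S]
    (P : Measure ((Fin p → ℝ) × S)) [IsFiniteMeasure P] (d : S × Y → ℝ≥0∞)
    (x : Fin p → ℝ) (y : Y) : ℝ≥0∞ :=
  ∫⁻ s, d (s, y) ∂(P.condKernel x)

/-- Law of the reproduction `Y` when `X` has law `PX` and `Y` is generated from `X` by the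
conditional law `κ`. -/
def reproLaw {p : ℕ} {Y : Type*} [MeasurableSpace Y] (PX : Measure (Fin p → ℝ))
    (κ : Kernel (Fin p → ℝ) Y) : Measure Y :=
  κ ∘ₘ PX

/-- Mutual information `I(X; Y)` (in nats), where `X` has law `PX` and `Y` is generated from `X`
by `κ`: the relative entropy of the joint law with respect to the product of the marginals. -/
def mutualInfo {p : ℕ} {Y : Type*} [MeasurableSpace Y] (PX : Measure (Fin p → ℝ))
    (κ : Kernel (Fin p → ℝ) Y) : ℝ≥0∞ :=
  InformationTheory.klDiv (PX ⊗ₘ κ) (PX.prod (reproLaw PX κ))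

/-- Expected reduced distortion of the test channel `κ`. -/
def expDistortion {p : ℕ} {S Y : Type*} [MeasurableSpace S] [StandardBorelSpace S] [Nonempty S]
    [MeasurableSpace Y] (P : Measure ((Fin p → ℝ) × S)) [IsFiniteMeasure P]
    (d : S × Y → ℝ≥0∞) (κ : Kernel (Fin p → ℝ) Y) : ℝ≥0∞ :=
  ∫⁻ x, ∫⁻ y, dbar P d x y ∂(κ x) ∂P.fst

/-- The indirect rate-distortion function `R(D)`. -/
def iRDF {p : ℕ} {S Y : Type*} [MeasurableSpace S] [StandardBorelSpace S] [Nonempty S]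
    [MeasurableSpace Y] (P : Measure ((Fin p → ℝ) × S)) [IsFiniteMeasure P]
    (d : S × Y → ℝ≥0∞) (D : ℝ≥0∞) : ℝ≥0∞ :=
  ⨅ (κ : Kernel (Fin p → ℝ) Y) (_ : IsMarkovKernel κ) (_ : expDistortion P d κ ≤ D),
    mutualInfo P.fst κ

/-- The Lagrangian `I(X; Y) + lam * E[dbar(X, Y)]` of the test channel `κ`. -/
def lagrangian {p : ℕ} {S Y : Type*} [MeasurableSpace S] [StandardBorelSpace S] [Nonempty S]
    [MeasurableSpace Y] (P : Measure ((Fin p → ℝ) × S)) [IsFiniteMeasure P]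
    (d : S × Y → ℝ≥0∞) (lam : ℝ) (κ : Kernel (Fin p → ℝ) Y) : ℝ≥0∞ :=
  mutualInfo P.fst κ + ENNReal.ofReal lam * expDistortion P d κ

/-- `κ` attains the infimum `F(lam)` of the Lagrangian over all test channels, and `F(lam)` is
finite. The point of the curve `R` with slope `-lam` that belongs to `κ` has the abscissa
`expDistortion P d κ`. -/
def IsOptimalChannel {p : ℕ} {S Y : Type*} [MeasurableSpace S] [StandardBorelSpace S]
    [Nonempty S] [MeasurableSpace Y] (P : Measure ((Fin p → ℝ) × S)) [IsFiniteMeasure P]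
    (d : S × Y → ℝ≥0∞) (lam : ℝ) (κ : Kernel (Fin p → ℝ) Y) : Prop :=
  lagrangian P d lam κ ≠ ∞ ∧
    ∀ κ' : Kernel (Fin p → ℝ) Y, IsMarkovKernel κ' →
      lagrangian P d lam κ ≤ lagrangian P d lam κ'

/-! ### Feed-forward networks -/

/-- A continuous squashing function: nondecreasing, with limits `0` and `1` at `-∞` and `∞`. -/
structure IsSquashing (σ : ℝ → ℝ) : Prop where
  continuous : Continuous σ
  monotone : Monotone σ
  tendsto_atBot : Tendsto σ atBot (𝓝 0)
  tendsto_atTop : Tendsto σ atTop (𝓝 1)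

/-- The `i`-th coordinate of a parameter vector, `0` out of range. -/
def coord {k : ℕ} (θ : EuclideanSpace ℝ (Fin k)) (i : ℕ) : ℝ :=
  if h : i < k then θ ⟨i, h⟩ else 0

/-- The feed-forward network from `ℝ^a` to `ℝ^b` with activation `σ`, one hidden layer and
parameter vector `θ` in `ℝ^k`. It has as many hidden units as `k` parameters allow; the `h`-th unit
owns `a + 1 + b` consecutive parameters: `a` input weights, a bias, and `b` output weights. -/
def net (σ : ℝ → ℝ) {k : ℕ} (a b : ℕ) (θ : EuclideanSpace ℝ (Fin k)) (x : Fin a → ℝ) :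
    Fin b → ℝ := fun o =>
  ∑ h ∈ Finset.range (k / (a + 1 + b)),
    coord θ (h * (a + 1 + b) + (a + 1) + o) *
      σ (∑ i : Fin a, coord θ (h * (a + 1 + b) + i) * x i + coord θ (h * (a + 1 + b) + a))

/-- Reproduction-mapping network. -/
def reproNet (σ : ℝ → ℝ) {k l q : ℕ} (θ : EuclideanSpace ℝ (Fin k)) (z : Fin l → ℝ) :
    Fin q → ℝ :=
  net σ l q θ z

/-- Distortion-estimator network, fed with the concatenation of `x` and `y`. -/
def distNet (σ : ℝ → ℝ) {k p q : ℕ} (θ : EuclideanSpace ℝ (Fin k)) (x : Fin p → ℝ)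
    (y : Fin q → ℝ) : ℝ :=
  net σ (p + q) 1 θ (Fin.append x y) 0

/-! ### The empirical estimate -/

/-- Empirical Lagrangian from the first `n` observations `x i` and the first `m` base samples
`z j`, for a distortion estimator `g` and a reproduction mapping `T`. -/
def empL {𝒳 𝒴 𝒵 : Type*} (lam : ℝ) (g : 𝒳 → 𝒴 → ℝ) (T : 𝒵 → 𝒴) (x : ℕ → 𝒳) (z : ℕ → 𝒵)
    (n m : ℕ) : ℝ :=
  -((1 / (n : ℝ)) * ∑ i ∈ Finset.range n,
    Real.log ((1 / (m : ℝ)) * ∑ j ∈ Finset.range m, Real.exp (-lam * g (x i) (T (z j)))))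

/-- Empirical distortion: the average over the observations of the mean of `g (x i) (T (z j))`
over `j` with normalized weights proportional to `exp (-lam * g (x i) (T (z j)))`. -/
def empD {𝒳 𝒴 𝒵 : Type*} (lam : ℝ) (g : 𝒳 → 𝒴 → ℝ) (T : 𝒵 → 𝒴) (x : ℕ → 𝒳) (z : ℕ → 𝒵)
    (n m : ℕ) : ℝ :=
  (1 / (n : ℝ)) * ∑ i ∈ Finset.range n, ∑ j ∈ Finset.range m,
    g (x i) (T (z j)) * (Real.exp (-lam * g (x i) (T (z j))) /
      ∑ j' ∈ Finset.range m, Real.exp (-lam * g (x i) (T (z j'))))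

/-- Empirical estimate of the rate. -/
def empR {𝒳 𝒴 𝒵 : Type*} (lam : ℝ) (g : 𝒳 → 𝒴 → ℝ) (T : 𝒵 → 𝒴) (x : ℕ → 𝒳) (z : ℕ → 𝒵)
    (n m : ℕ) : ℝ :=
  empL lam g T x z n m - lam * empD lam g T x z n m

/-- The real number `t` is `ε`-close to the extended number `a`: within `ε` of it when `a` is
finite, and at least `1 / ε` when `a = ∞`. -/
def CloseTo (ε t : ℝ) (a : ℝ≥0∞) : Prop :=
  (a ≠ ∞ → |t - a.toReal| ≤ ε) ∧ (a = ∞ → 1 / ε ≤ t)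

end

end IndirectRD

/-!
An optimal channel is the Gibbs channel of its own reproduction law `Q*`: by the Gibbs variational
principle, replacing a channel by the Gibbs channel of its reproduction law lowers the Lagrangian
unless the two agree. Hence `R(D)` is the mean over `X` of the relative entropies of the Gibbs laws
with base `Q*` and energy `lam * dbar`, and it is the limit of the same quantity for the truncations
of `dbar`.

The mean Gibbs rate of a bounded estimator is continuous under bounded pointwise limits, and every
bounded measurable function is reached from networks with one hidden layer by iterating such limits:
step functions of a linear form, trigonometric polynomials, continuous functions and finally, by the
functional monotone class theorem, measurable ones. As the base law is non-atomic, some measurable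
map transports it exactly to `Q*`, and this map is an almost everywhere limit of networks.

Networks are bounded and uniformly continuous, so for fixed parameters the strong law in the Banach
space of bounded continuous functions makes the averages over the base samples converge uniformly in
the observation; the two sample sizes may then grow independently of each other.
-/

namespace IndirectRD

/-! ### Closure under bounded pointwise limits -/

/-- The closure of a set of functions under pointwise limits of uniformly bounded sequences. -/
inductive BddClosure {α : Type*} (N : Set (α → ℝ)) : (α → ℝ) → Prop
  | base {f : α → ℝ} : f ∈ N → BddClosure N f
  | lim {f : ℕ → α → ℝ} {g : α → ℝ} {C : ℝ} : (∀ n, BddClosure N (f n)) →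
      (∀ n x, |f n x| ≤ C) → (∀ x, Tendsto (fun n => f n x) atTop (𝓝 (g x))) → BddClosure N g

namespace BddClosure

variable {α β : Type*}

section Set

variable {N : Set (α → ℝ)} {f : α → ℝ}

lemma bounded (hN : ∀ f ∈ N, ∃ C, ∀ x, |f x| ≤ C) (hf : BddClosure N f) :
    ∃ C, ∀ x, |f x| ≤ C := by
  cases hf with
  | base hf => exact hN _ hf
  | lim _ hbdd hlim => exact ⟨_, fun x => le_of_tendsto (hlim x).abs (.of_forall (hbdd · x))⟩

lemma measurable [MeasurableSpace α] (hN : ∀ f ∈ N, Measurable f) (hf : BddClosure N f) :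
    Measurable f := by
  induction hf with
  | base hf => exact hN _ hf
  | lim _ _ hlim ih => exact measurable_of_tendsto_metrizable ih (tendsto_pi_nhds.2 hlim)

lemma comp {N' : Set (β → ℝ)} (φ : β → α) (h : ∀ f ∈ N, BddClosure N' (f ∘ φ))
    (hf : BddClosure N f) : BddClosure N' (f ∘ φ) := by
  induction hf with
  | base hf => exact h _ hf
  | lim _ hbdd hlim ih => exact lim ih (fun n x => hbdd n (φ x)) (fun x => hlim (φ x))

lemma exists_mem_of_open (O : (α → ℝ) → Prop)
    (hO : ∀ (f : ℕ → α → ℝ) (g : α → ℝ) (C : ℝ), (∀ n, BddClosure N (f n)) →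
      (∀ n x, |f n x| ≤ C) → (∀ x, Tendsto (fun n => f n x) atTop (𝓝 (g x))) → O g →
      ∃ n, O (f n)) (hf : BddClosure N f) (h : O f) : ∃ g ∈ N, O g := by
  induction hf with
  | base hf => exact ⟨_, hf, h⟩
  | lim hmem hbdd hlim ih => exact (hO _ _ _ hmem hbdd hlim h).elim ih

lemma comp_of_separatesPoints {K : Type*} [TopologicalSpace K] [CompactSpace K]
    {A : Subalgebra ℝ C(K, ℝ)} (hA : A.SeparatesPoints) (φ : α → K)
    (h : ∀ g ∈ A, BddClosure N (g ∘ φ)) (f : C(K, ℝ)) : BddClosure N (f ∘ φ) := by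
  have hf : f ∈ closure (A : Set C(K, ℝ)) :=
    ContinuousMap.continuousMap_mem_subalgebra_closure_of_separatesPoints A hA f
  obtain ⟨g, hgA, hgf⟩ := mem_closure_iff_seq_limit.1 hf
  obtain ⟨C, hC⟩ := hgf.norm.bddAbove_range
  exact lim (fun n => h _ (hgA n))
    (fun n x => ((g n).norm_coe_le_norm _).trans (hC ⟨n, rfl⟩))
    fun x => ((continuous_eval_const (φ x)).tendsto f).comp hgf

end Set

variable {N : Submodule ℝ (α → ℝ)}

lemma smul (c : ℝ) {f : α → ℝ} (hf : BddClosure (N : Set (α → ℝ)) f) :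
    BddClosure (N : Set (α → ℝ)) (c • f) := by
  induction hf with
  | base hf => exact base (N.smul_mem c hf)
  | @lim f g C _ hbdd hlim ih =>
    refine lim (C := |c| * C) ih (fun n x => ?_) (fun x => (hlim x).const_mul c)
    simpa [abs_mul] using mul_le_mul_of_nonneg_left (hbdd n x) (abs_nonneg c)

lemma add (hN : ∀ f ∈ N, ∃ C, ∀ x, |f x| ≤ C) {f g : α → ℝ}
    (hf : BddClosure (N : Set (α → ℝ)) f) (hg : BddClosure (N : Set (α → ℝ)) g) :
    BddClosure (N : Set (α → ℝ)) (f + g) := by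
  induction hf with
  | @base f hf =>
    induction hg with
    | base hg => exact base (N.add_mem hf hg)
    | lim _ hbdd hlim ih =>
      obtain ⟨B, hB⟩ := hN _ hf
      exact lim ih (fun n x => (abs_add_le _ _).trans (add_le_add (hB x) (hbdd n x)))
        (fun x => (hlim x).const_add (f x))
  | lim _ hbdd hlim ih =>
    obtain ⟨B, hB⟩ := bounded hN hg
    exact lim ih (fun n x => (abs_add_le _ _).trans (add_le_add (hbdd n x) (hB x)))
      (fun x => (hlim x).add_const (g x))

/-- The bounded pointwise closure of a linear space of bounded functions, as a linear space. -/
def submodule (N : Submodule ℝ (α → ℝ)) (hN : ∀ f ∈ N, ∃ C, ∀ x, |f x| ≤ C) :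
    Submodule ℝ (α → ℝ) where
  carrier := {f | BddClosure (N : Set (α → ℝ)) f}
  add_mem' := add hN
  zero_mem' := base N.zero_mem
  smul_mem' c _ := smul c

/-! ### The functional monotone class theorem -/

variable (hN : ∀ f ∈ N, ∃ C, ∀ x, |f x| ≤ C)
include hN

lemma indicator_iUnion {t : ℕ → Set α} (hd : Pairwise (Function.onFun Disjoint t))
    (ht : ∀ i, BddClosure (N : Set (α → ℝ)) ((t i).indicator 1)) :
    BddClosure (N : Set (α → ℝ)) ((⋃ i, t i).indicator 1) := by
  have hpartial n : BddClosure (N : Set (α → ℝ)) ((⋃ i ∈ Finset.range n, t i).indicator 1) := by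
    have hsum : (⋃ i ∈ Finset.range n, t i).indicator 1 =
        ∑ i ∈ Finset.range n, (t i).indicator (1 : α → ℝ) := by
      rw [Finset.indicator_biUnion _ _ (hd.set_pairwise _)]
      ext x
      rw [Finset.sum_apply]
    exact hsum ▸ (submodule N hN).sum_mem fun i _ => ht i
  refine lim (C := 1) hpartial (fun n x => ?_) fun x => ?_
  · simpa using norm_indicator_le_norm_self (s := ⋃ i ∈ Finset.range n, t i) (1 : α → ℝ) x
  · exact ((tendsto_indicator_biUnion_finset t 1 x).mono_right (pure_le_nhds _)).comp
      Filter.tendsto_finset_range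

variable [MeasurableSpace α] {s : Set (Set α)}

lemma indicator_of_measurableSet
    (hgen : ‹MeasurableSpace α› = MeasurableSpace.generateFrom s) (hpi : IsPiSystem s)
    (hone : BddClosure (N : Set (α → ℝ)) 1)
    (hs : ∀ t ∈ s, BddClosure (N : Set (α → ℝ)) (t.indicator 1)) {t : Set α}
    (ht : MeasurableSet t) : BddClosure (N : Set (α → ℝ)) (t.indicator 1) := by
  induction t, ht using MeasurableSpace.induction_on_inter hgen hpi with
  | empty => exact Set.indicator_empty (M := ℝ) _ ▸ base N.zero_mem
  | basic t ht => exact hs t ht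
  | compl t _ ih => exact Set.indicator_compl t (1 : α → ℝ) ▸ (submodule N hN).sub_mem hone ih
  | iUnion t hd _ ih => exact indicator_iUnion hN hd ih

lemma of_measurable
    (hgen : ‹MeasurableSpace α› = MeasurableSpace.generateFrom s) (hpi : IsPiSystem s)
    (hone : BddClosure (N : Set (α → ℝ)) 1)
    (hs : ∀ t ∈ s, BddClosure (N : Set (α → ℝ)) (t.indicator 1)) {f : α → ℝ}
    (hf : Measurable f) {C : ℝ} (hC : ∀ x, |f x| ≤ C) : BddClosure (N : Set (α → ℝ)) f := by
  have hsimple (g : SimpleFunc α ℝ) : BddClosure (N : Set (α → ℝ)) g := by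
    induction g using SimpleFunc.induction with
    | const c ht =>
      convert smul c (indicator_of_measurableSet hN hgen hpi hone hs ht) using 1
      ext x
      simp [Set.indicator, Set.piecewise]
    | add _ hg hg' => exact add hN hg hg'
  have happrox := hf.stronglyMeasurable.norm_approxBounded_le (c := |C|) (abs_nonneg C)
  exact lim (fun n => hsimple (hf.stronglyMeasurable.approxBounded |C| n)) (fun n x => happrox n x)
    fun x => hf.stronglyMeasurable.tendsto_approxBounded_of_norm_le
      ((hC x).trans (le_abs_self C))

lemma of_forall_continuous [TopologicalSpace α] [HasOuterApproxClosed α] [BorelSpace α]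
    (hcont : ∀ f : α → ℝ, Continuous f → (∃ C, ∀ x, |f x| ≤ C) → BddClosure (N : Set (α → ℝ)) f)
    {f : α → ℝ} (hf : Measurable f) {C : ℝ} (hC : ∀ x, |f x| ≤ C) :
    BddClosure (N : Set (α → ℝ)) f := by
  have hindicator (t : Set α) (ht : IsClosed t) : BddClosure (N : Set (α → ℝ)) (t.indicator 1) := by
    have hbdd n x : |(ht.apprSeq n x : ℝ)| ≤ 1 := by
      rw [NNReal.abs_eq]
      exact_mod_cast HasOuterApproxClosed.apprSeq_apply_le_one ht n x
    refine lim (fun n => hcont _ (by fun_prop) ⟨1, hbdd n⟩) hbdd fun x => ?_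
    have hlim := tendsto_pi_nhds.1 (HasOuterApproxClosed.tendsto_apprSeq ht) x
    have hcoe : t.indicator 1 x = ((t.indicator (fun _ => 1) x : NNReal) : ℝ) := by
      by_cases hx : x ∈ t <;> simp [hx]
    exact hcoe ▸ (NNReal.continuous_coe.tendsto _).comp hlim
  exact of_measurable hN (BorelSpace.measurable_eq.trans borel_eq_generateFrom_isClosed)
    isPiSystem_isClosed (hcont 1 continuous_const ⟨1, by simp⟩) hindicator hf hC

end BddClosure

/-! ### Density of networks -/

namespace IsSquashing

variable {σ : ℝ → ℝ}

lemma nonneg (hσ : IsSquashing σ) (t : ℝ) : 0 ≤ σ t := hσ.monotone.le_of_tendsto hσ.tendsto_atBot t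

lemma le_one (hσ : IsSquashing σ) (t : ℝ) : σ t ≤ 1 := hσ.monotone.ge_of_tendsto hσ.tendsto_atTop t

lemma abs_le_one (hσ : IsSquashing σ) (t : ℝ) : |σ t| ≤ 1 := by
  rw [abs_of_nonneg (hσ.nonneg t)]
  exact hσ.le_one t

lemma tendsto_indicator_Ici (hσ : IsSquashing σ) (c t : ℝ) :
    Tendsto (fun n : ℕ => σ (n * t + (√n - n * c))) atTop (𝓝 ((Set.Ici c).indicator 1 t)) := by
  have hsqrt : Tendsto (fun n : ℕ => √(n : ℝ)) atTop atTop :=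
    Real.tendsto_sqrt_atTop.comp tendsto_natCast_atTop_atTop
  by_cases hct : c ≤ t
  · rw [Set.indicator_of_mem (Set.mem_Ici.2 hct)]
    refine hσ.tendsto_atTop.comp (tendsto_atTop_mono (fun n => ?_) hsqrt)
    linarith [mul_le_mul_of_nonneg_left hct (Nat.cast_nonneg (α := ℝ) n)]
  · rw [Set.indicator_of_notMem (Set.notMem_Ici.2 (not_le.1 hct))]
    have hfactor : Tendsto (fun n : ℕ => √(n : ℝ) * (√n * (t - c) + 1)) atTop atBot :=
      hsqrt.atTop_mul_atBot₀ (tendsto_atBot_add_const_right _ _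
        (hsqrt.atTop_mul_const_of_neg (sub_neg.2 (not_le.1 hct))))
    refine hσ.tendsto_atBot.comp (hfactor.congr fun n => ?_)
    linear_combination (t - c) * Real.mul_self_sqrt (Nat.cast_nonneg (α := ℝ) n)

end IsSquashing

section Ridge

variable {σ : ℝ → ℝ} {V W : Type*} [AddCommGroup V] [Module ℝ V] [TopologicalSpace V]
  [AddCommGroup W] [Module ℝ W] [TopologicalSpace W]

/-- The space of scalar networks on `V` with one hidden layer and activation `σ`. -/
noncomputable def ridge (σ : ℝ → ℝ) (V : Type*) [AddCommGroup V] [Module ℝ V] [TopologicalSpace V] :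
    Submodule ℝ (V → ℝ) :=
  Submodule.span ℝ (Set.range fun (u : (V →L[ℝ] ℝ) × ℝ) x => σ (u.1 x + u.2))

lemma mem_ridge (ℓ : V →L[ℝ] ℝ) (b : ℝ) : (fun x => σ (ℓ x + b)) ∈ ridge σ V :=
  Submodule.subset_span ⟨(ℓ, b), rfl⟩

lemma ridge_bounded (hσ : IsSquashing σ) : ∀ f ∈ ridge σ V, ∃ C, ∀ x, |f x| ≤ C := by
  intro f hf
  induction hf using Submodule.span_induction with
  | mem f hf => obtain ⟨u, rfl⟩ := hf; exact ⟨1, fun x => hσ.abs_le_one _⟩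
  | zero => exact ⟨0, fun x => by simp⟩
  | add f g _ _ hf hg =>
    obtain ⟨B, hB⟩ := hf
    obtain ⟨C, hC⟩ := hg
    exact ⟨B + C, fun x => (abs_add_le _ _).trans (add_le_add (hB x) (hC x))⟩
  | smul c f _ hf =>
    obtain ⟨C, hC⟩ := hf
    exact ⟨|c| * C, fun x => (abs_mul _ _).trans_le (by gcongr; exact hC x)⟩

lemma ridge_comp {f : W → ℝ} (hf : f ∈ ridge σ W) (A : V →L[ℝ] W) : f ∘ A ∈ ridge σ V := by
  have hle : ridge σ W ≤ (ridge σ V).comap (LinearMap.funLeft ℝ ℝ A) := by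
    refine Submodule.span_le.2 ?_
    rintro _ ⟨u, rfl⟩
    exact mem_ridge (u.1.comp A) u.2
  exact hle hf

lemma ridge_closure_one (hσ : IsSquashing σ) : BddClosure (ridge σ V : Set (V → ℝ)) 1 :=
  .lim (fun n : ℕ => .base (mem_ridge 0 n)) (fun n x => hσ.abs_le_one _) fun x => by
    simpa [Function.comp_def] using hσ.tendsto_atTop.comp tendsto_natCast_atTop_atTop

lemma ridge_closure_real (hσ : IsSquashing σ) {φ : ℝ → ℝ} (hφ : Measurable φ) {C : ℝ}
    (hC : ∀ t, |φ t| ≤ C) : BddClosure (ridge σ ℝ : Set (ℝ → ℝ)) φ := by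
  refine .of_measurable (ridge_bounded hσ) (s := Set.range Set.Ici)
    (BorelSpace.measurable_eq.trans (borel_eq_generateFrom_Ici ℝ)) isPiSystem_Ici
    (ridge_closure_one hσ) ?_ hφ hC
  rintro _ ⟨c, rfl⟩
  exact .lim (fun n => .base (mem_ridge (ContinuousLinearMap.lsmul ℝ ℝ (n : ℝ)) _))
    (fun n t => hσ.abs_le_one _) (hσ.tendsto_indicator_Ici c)

lemma ridge_closure_comp_linear (hσ : IsSquashing σ) {φ : ℝ → ℝ} (hφ : Measurable φ) {C : ℝ}
    (hC : ∀ t, |φ t| ≤ C) (ℓ : V →L[ℝ] ℝ) : BddClosure (ridge σ V : Set (V → ℝ)) (φ ∘ ℓ) :=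
  (ridge_closure_real hσ hφ hC).comp ℓ fun _ hf => .base (ridge_comp hf ℓ)

/-- The plane wave `cos (ℓ x + b)`. -/
noncomputable def wave (u : (V →L[ℝ] ℝ) × ℝ) : C(V, ℝ) :=
  ⟨fun x => Real.cos (u.1 x + u.2), by fun_prop⟩

lemma wave_mul_wave (u v : (V →L[ℝ] ℝ) × ℝ) :
    wave u * wave v = (1 / 2 : ℝ) • (wave (u - v) + wave (u + v)) := by
  ext x
  have harg_sub : (u.1 x + u.2) - (v.1 x + v.2) = (u - v).1 x + (u - v).2 := add_sub_add_comm ..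
  have harg_add : (u.1 x + u.2) + (v.1 x + v.2) = (u + v).1 x + (u + v).2 := add_add_add_comm ..
  have hcos := Real.two_mul_cos_mul_cos (u.1 x + u.2) (v.1 x + v.2)
  rw [harg_sub, harg_add] at hcos
  simp only [wave, ContinuousMap.mul_apply, ContinuousMap.smul_apply, ContinuousMap.add_apply,
    ContinuousMap.coe_mk, smul_eq_mul]
  linarith

variable (V) in
/-- The algebra of real trigonometric polynomials on `V`, defined as the linear span of the plane
waves. -/
noncomputable def trigPoly : Subalgebra ℝ C(V, ℝ) :=
  (Submodule.span ℝ (Set.range wave)).toSubalgebra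
    (Submodule.subset_span ⟨0, by ext; simp [wave]⟩) fun f g hf hg => by
      refine (Submodule.span_mul_span ℝ _ _).le.trans (Submodule.span_le.2 ?_)
        (Submodule.mul_mem_mul hf hg)
      rintro _ ⟨_, ⟨u, rfl⟩, _, ⟨v, rfl⟩, rfl⟩
      change wave u * wave v ∈ _
      rw [wave_mul_wave]
      exact Submodule.smul_mem _ _ (Submodule.add_mem _
        (Submodule.subset_span ⟨_, rfl⟩) (Submodule.subset_span ⟨_, rfl⟩))

lemma ridge_closure_wave (hσ : IsSquashing σ) (u : (V →L[ℝ] ℝ) × ℝ) :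
    BddClosure (ridge σ V : Set (V → ℝ)) (wave u) :=
  ridge_closure_comp_linear hσ (φ := fun t => Real.cos (t + u.2)) (by fun_prop)
    (fun _ => Real.abs_cos_le_one _) u.1

lemma ridge_closure_trigPoly (hσ : IsSquashing σ) {f : C(V, ℝ)} (hf : f ∈ trigPoly V) :
    BddClosure (ridge σ V : Set (V → ℝ)) f := by
  have hle : (trigPoly V).toSubmodule ≤ (BddClosure.submodule _ (ridge_bounded hσ)).comap
      (ContinuousMap.coeFnLinearMap ℝ) := by
    refine Submodule.span_le.2 ?_
    rintro _ ⟨u, rfl⟩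
    exact ridge_closure_wave hσ u
  exact hle hf

end Ridge

section Pi

variable {σ : ℝ → ℝ} {ι : Type*}

/-- The coordinatewise sine with period `2 * π * L`, as a map to the cube. It is used to
approximate a function on `ι → ℝ` by functions that factor through a compact space. -/
noncomputable def sineMap (L : ℝ) : C(ι → ℝ, ι → Set.Icc (-1 : ℝ) 1) where
  toFun x i := ⟨Real.sin (x i / L), Real.sin_mem_Icc _⟩

lemma sineMap_mem_trigPoly (L : ℝ) (i : ι) :
    (⟨fun x => sineMap L x i, by fun_prop⟩ : C(ι → ℝ, ℝ)) ∈ trigPoly (ι → ℝ) := by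
  have hwave : (⟨fun x => sineMap L x i, by fun_prop⟩ : C(ι → ℝ, ℝ)) =
      wave (L⁻¹ • ContinuousLinearMap.proj i, -(Real.pi / 2)) := by
    ext x
    simp only [sineMap, wave, ContinuousMap.coe_mk, smul_apply,
      ContinuousLinearMap.proj_apply, smul_eq_mul, ← sub_eq_add_neg, Real.cos_sub_pi_div_two,
      inv_mul_eq_div]
  exact hwave ▸ Submodule.subset_span ⟨_, rfl⟩

lemma ridge_closure_comp_sineMap (hσ : IsSquashing σ) (L : ℝ) (f : C(ι → Set.Icc (-1 : ℝ) 1, ℝ)) :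
    BddClosure (ridge σ (ι → ℝ) : Set ((ι → ℝ) → ℝ)) (f ∘ sineMap L) := by
  refine .comp_of_separatesPoints
    (A := (trigPoly (ι → ℝ)).comap (ContinuousMap.compRightAlgHom ℝ ℝ (sineMap L))) ?_ _
    (fun g hg => ridge_closure_trigPoly hσ (f := g.comp (sineMap L)) hg) f
  intro u v huv
  obtain ⟨i, hi⟩ := Function.ne_iff.1 huv
  exact ⟨_, ⟨⟨fun w => w i, by fun_prop⟩, sineMap_mem_trigPoly L i, rfl⟩,
    fun h => hi (Subtype.ext h)⟩

lemma tendsto_mul_sin_div (t : ℝ) :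
    Tendsto (fun n : ℕ => ((n : ℝ) + 1) * Real.sin (t / (n + 1))) atTop (𝓝 t) := by
  have hdiv : Tendsto (fun n : ℕ => t / ((n : ℝ) + 1)) atTop (𝓝 0) := by
    simpa [div_eq_mul_inv] using tendsto_one_div_add_atTop_nhds_zero_nat.const_mul t
  have hsinc := ((Real.continuous_sinc.tendsto 0).comp hdiv).const_mul t
  rw [Real.sinc_zero, mul_one] at hsinc
  refine hsinc.congr fun n => ?_
  rcases eq_or_ne t 0 with rfl | ht
  · simp
  · rw [Function.comp_apply, Real.sinc_of_ne_zero (by positivity)]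
    field_simp

lemma ridge_closure_continuous (hσ : IsSquashing σ) {f : (ι → ℝ) → ℝ} (hf : Continuous f) {C : ℝ}
    (hC : ∀ x, |f x| ≤ C) : BddClosure (ridge σ (ι → ℝ) : Set ((ι → ℝ) → ℝ)) f :=
  .lim (fun n : ℕ => ridge_closure_comp_sineMap hσ (n + 1)
    ⟨fun u => f fun i => (n + 1) * u i, by fun_prop⟩) (fun _ _ => hC _)
    fun x => (hf.tendsto x).comp (tendsto_pi_nhds.2 fun i => tendsto_mul_sin_div (x i))

theorem ridge_closure_measurable [Countable ι] (hσ : IsSquashing σ) {f : (ι → ℝ) → ℝ}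
    (hf : Measurable f) {C : ℝ} (hC : ∀ x, |f x| ≤ C) :
    BddClosure (ridge σ (ι → ℝ) : Set ((ι → ℝ) → ℝ)) f :=
  .of_forall_continuous (ridge_bounded hσ)
    (fun _ hg ⟨_, hB⟩ => ridge_closure_continuous hσ hg hB) hf hC

end Pi

/-! ### Networks as parametrized families -/

section Params

variable {s k : ℕ} [NeZero s]

/-- The parameter vector that lists the weights of the hidden units `0, 1, …` one unit after the
other, truncated to `k` entries. -/
noncomputable def packParams (k : ℕ) (W : ℕ → Fin s → ℝ) : EuclideanSpace ℝ (Fin k) :=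
  WithLp.toLp 2 fun i => W (i / s) (Fin.ofNat s i)

lemma coord_packParams (W : ℕ → Fin s → ℝ) {h : ℕ} (hh : h < k / s) (r : Fin s) :
    coord (packParams k W) (h * s + r) = W h r := by
  have hlt : h * s + r < k := by
    have hle : (h + 1) * s ≤ k := (Nat.le_div_iff_mul_le (Nat.pos_of_neZero s)).1 hh
    linarith [add_one_mul h s, r.isLt]
  have hdiv : (h * s + r) / s = h := by
    rw [Nat.mul_comm, Nat.mul_add_div (Nat.pos_of_neZero s), Nat.div_eq_of_lt r.isLt, add_zero]
  have hmod : Fin.ofNat s (h * s + r) = r := by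
    ext
    rw [Fin.val_ofNat, Nat.mul_comm, Nat.mul_add_mod, Nat.mod_eq_of_lt r.isLt]
  simp only [coord, hlt, dif_pos, packParams, hdiv, hmod]

end Params

section Net

variable {σ : ℝ → ℝ} {a b : ℕ}

local instance : NeZero (a + 1 + b) := ⟨by omega⟩

lemma net_packParams (w : ℕ → Fin a → ℝ) (β : ℕ → ℝ) (c : ℕ → Fin b → ℝ) (k : ℕ) (x : Fin a → ℝ)
    (o : Fin b) :
    net σ a b (packParams k fun h => Fin.append (Fin.snoc (w h) (β h)) (c h)) x o =
      ∑ h ∈ Finset.range (k / (a + 1 + b)), c h o * σ (∑ i, w h i * x i + β h) := by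
  refine Finset.sum_congr rfl fun h hh => ?_
  have hcoord := coord_packParams (fun h => Fin.append (Fin.snoc (w h) (β h)) (c h))
    (Finset.mem_range.1 hh)
  have hinput (i : Fin a) := hcoord (Fin.castAdd b i.castSucc)
  have hbias := hcoord (Fin.castAdd b (Fin.last a))
  have houtput := hcoord (Fin.natAdd (a + 1) o)
  simp only [Fin.append_left, Fin.append_right, Fin.snoc_castSucc, Fin.snoc_last, Fin.val_castAdd,
    Fin.val_natAdd, Fin.val_castSucc, Fin.val_last, ← add_assoc] at hinput hbias houtput
  simp only [← add_assoc, hinput, hbias, houtput]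

lemma exists_shared_hidden_units {V κ : Type*} [AddCommGroup V] [Module ℝ V] [TopologicalSpace V]
    [Finite κ] {T : V → κ → ℝ} (hT : ∀ o, (T · o) ∈ ridge σ V) :
    ∃ (H : ℕ) (u : Fin H → (V →L[ℝ] ℝ) × ℝ) (c : Fin H → κ → ℝ),
      ∀ x o, T x o = ∑ h, c h o * σ ((u h).1 x + (u h).2) := by
  classical
  have := Fintype.ofFinite κ
  choose c hc using fun o => Finsupp.mem_span_range_iff_exists_finsupp.1 (hT o)
  let s := Finset.univ.biUnion fun o => (c o).support
  refine ⟨s.card, fun h => (s.equivFin.symm h).1, fun h o => c o (s.equivFin.symm h).1,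
    fun x o => ?_⟩
  rw [← congrFun (hc o) x, s.equivFin.symm.sum_comp fun u : s => c o u * σ (u.1.1 x + u.1.2),
    Finset.sum_coe_sort s fun u => c o u * σ (u.1 x + u.2),
    Finsupp.sum_of_support_subset _
      (Finset.subset_biUnion_of_mem (fun o => (c o).support) (Finset.mem_univ o)) _ (by simp)]
  simp [s]

theorem eventually_exists_net_eq {T : (Fin a → ℝ) → Fin b → ℝ}
    (hT : ∀ o, (T · o) ∈ ridge σ (Fin a → ℝ)) :
    ∀ᶠ k in atTop, ∃ θ : EuclideanSpace ℝ (Fin k), net σ a b θ = T := by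
  obtain ⟨H, u, c, hu⟩ := exists_shared_hidden_units hT
  filter_upwards [eventually_ge_atTop (H * (a + 1 + b))] with k hk
  refine ⟨packParams k fun h => Fin.append
    (Fin.snoc (Function.extend Fin.val (fun h i => (u h).1 fun j => if i = j then 1 else 0) 0 h)
      (Function.extend Fin.val (fun h => (u h).2) 0 h)) (Function.extend Fin.val c 0 h), ?_⟩
  ext x o
  have hH : H ≤ k / (a + 1 + b) := (Nat.le_div_iff_mul_le (Nat.pos_of_neZero _)).2 hk
  rw [net_packParams, hu, ← Finset.sum_subset (Finset.range_mono hH), Finset.sum_range]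
  · refine Finset.sum_congr rfl fun h _ => ?_
    have hform : (u h).1 x = ∑ i, (u h).1 (fun j => if i = j then 1 else 0) * x i := by
      simpa [mul_comm] using (u h).1.toLinearMap.pi_apply_eq_sum_univ x
    simp only [Fin.val_injective.extend_apply, hform]
  · intro h _ hh
    rw [Function.extend_apply' c]
    · simp
    · rintro ⟨i, rfl⟩
      exact hh (Finset.mem_range.2 i.isLt)

end Net

/-! ### Transport of non-atomic laws -/

section Transport

lemma continuous_cdf (ν : Measure ℝ) [IsProbabilityMeasure ν] [NullSingletonClass ν] :
    Continuous (cdf ν) := by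
  refine continuous_iff_continuousAt.2 fun x =>
    (monotone_cdf ν).continuousAt_iff_leftLim_eq_rightLim.2 ?_
  have hjump : ENNReal.ofReal (cdf ν x - Function.leftLim (cdf ν) x) = 0 := by
    rw [← StieltjesFunction.measure_singleton, measure_cdf, measure_singleton]
  rw [(cdf ν).rightLim_eq]
  exact le_antisymm ((monotone_cdf ν).leftLim_le le_rfl)
    (sub_nonpos.1 (ENNReal.ofReal_eq_zero.1 hjump))

lemma measure_setOf_cdf_le (ν : Measure ℝ) [IsProbabilityMeasure ν] [NullSingletonClass ν] {u : ℝ}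
    (hu : u ∈ Set.Icc (0 : ℝ) 1) : ν {x | cdf ν x ≤ u} = ENNReal.ofReal u := by
  rcases hu.2.eq_or_lt with rfl | hu1
  · simp [cdf_le_one]
  by_cases hne : ∃ y, cdf ν y ≤ u
  swap
  · push Not at hne
    have hu0 : u ≤ 0 := ge_of_tendsto' (tendsto_cdf_atBot ν) fun y => (hne y).le
    simp [ENNReal.ofReal_of_nonpos hu0, (hne _).not_ge]
  have hcont := continuous_cdf ν
  have hbdd : BddAbove {x | cdf ν x ≤ u} := by
    obtain ⟨b, hb⟩ := ((tendsto_cdf_atTop ν).eventually_const_lt hu1).exists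
    exact ⟨b, fun x hx => ((monotone_cdf ν).reflect_lt (lt_of_le_of_lt hx hb)).le⟩
  have hclosed : IsClosed {x | cdf ν x ≤ u} := isClosed_le hcont continuous_const
  obtain ⟨y, hy⟩ : ∃ y, cdf ν y = u := mem_range_of_exists_le_of_exists_ge hcont hne
    (((tendsto_cdf_atTop ν).eventually_const_lt hu1).exists.imp fun _ h => h.le)
  have hmax := hclosed.csSup_mem hne hbdd
  have hIic : {x | cdf ν x ≤ u} = Set.Iic (sSup {x | cdf ν x ≤ u}) :=
    Set.Subset.antisymm (fun x hx => le_csSup hbdd hx)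
      fun x hx => ((monotone_cdf ν) hx).trans hmax
  have hge : u ≤ cdf ν (sSup {x | cdf ν x ≤ u}) :=
    hy.ge.trans (monotone_cdf ν (le_csSup hbdd hy.le))
  rw [hIic, ← ofReal_cdf, le_antisymm hmax hge]

/-- The distribution function as a map to the unit interval: the probability integral transform. -/
noncomputable def cdfUnit (ν : Measure ℝ) (x : ℝ) : unitInterval :=
  ⟨cdf ν x, cdf_nonneg ν x, cdf_le_one ν x⟩

lemma measurable_cdfUnit (ν : Measure ℝ) : Measurable (cdfUnit ν) :=
  (monotone_cdf ν).measurable.subtype_mk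

lemma map_cdfUnit_eq_volume (ν : Measure ℝ) [IsProbabilityMeasure ν] [NullSingletonClass ν] :
    ν.map (cdfUnit ν) = volume := by
  refine Measure.ext_of_Iic _ _ fun u => ?_
  rw [Measure.map_apply (measurable_cdfUnit ν) measurableSet_Iic, unitInterval.volume_Iic]
  exact measure_setOf_cdf_le ν u.2

variable {α β : Type*} [MeasurableSpace α] [StandardBorelSpace α] [MeasurableSpace β]
  [StandardBorelSpace β]

lemma exists_measurable_map_eq_volume (μ : Measure α) [IsProbabilityMeasure μ]
    [NullSingletonClass μ] : ∃ F : α → unitInterval, Measurable F ∧ μ.map F = volume := by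
  obtain ⟨e, he⟩ := exists_measurableEmbedding_real α
  have := Measure.isProbabilityMeasure_map (μ := μ) he.measurable.aemeasurable
  have : NullSingletonClass (μ.map e) := ⟨fun x => by
    rw [he.map_apply]
    exact (Set.subsingleton_singleton.preimage he.injective).measure_zero μ⟩
  have hcdf := measurable_cdfUnit (μ.map e)
  exact ⟨_, hcdf.comp he.measurable, by
    rw [← Measure.map_map hcdf he.measurable, map_cdfUnit_eq_volume]⟩

theorem exists_measurable_transport (μ : Measure α) [IsProbabilityMeasure μ]
    [NullSingletonClass μ] (ν : Measure β) [IsProbabilityMeasure ν] :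
    ∃ T : α → β, Measurable T ∧ μ.map T = ν := by
  obtain ⟨F, hF, hμF⟩ := exists_measurable_map_eq_volume μ
  have : Nonempty β := nonempty_of_isProbabilityMeasure ν
  obtain ⟨f, hf, hfν⟩ := ν.exists_measurable_map_eq
  exact ⟨f ∘ F, hf.comp hF, by rw [← Measure.map_map hf hF, hμF, hfν]⟩

end Transport

/-! ### The Gibbs variational principle -/

/-- `exp (-a)` for an extended nonnegative number `a`, with value `0` at `∞`. -/
noncomputable def expNeg (a : ℝ≥0∞) : ℝ := if a = ∞ then 0 else Real.exp (-a.toReal)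

@[simp] lemma expNeg_top : expNeg ∞ = 0 := by simp [expNeg]

lemma expNeg_of_ne_top {a : ℝ≥0∞} (ha : a ≠ ∞) : expNeg a = Real.exp (-a.toReal) := by
  simp [expNeg, ha]

lemma expNeg_nonneg (a : ℝ≥0∞) : 0 ≤ expNeg a := by
  unfold expNeg; split_ifs <;> positivity

lemma expNeg_pos {a : ℝ≥0∞} (ha : a ≠ ∞) : 0 < expNeg a := by
  rw [expNeg_of_ne_top ha]; positivity

lemma expNeg_le_one (a : ℝ≥0∞) : expNeg a ≤ 1 := by
  unfold expNeg
  split_ifs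
  · exact zero_le_one
  · exact Real.exp_le_one_iff.2 (neg_nonpos.2 ENNReal.toReal_nonneg)

lemma expNeg_mul_log_expNeg (a : ℝ≥0∞) :
    expNeg a * Real.log (expNeg a) = -(expNeg a * a.toReal) := by
  by_cases ha : a = ∞
  · simp [ha]
  · rw [expNeg_of_ne_top ha, Real.log_exp, mul_neg]

lemma measurable_expNeg : Measurable expNeg :=
  Measurable.ite (measurableSet_singleton ∞) measurable_const (by fun_prop)

section Gibbs

open InformationTheory

variable {α β : Type*} [MeasurableSpace β]

/-- The partition function of the energy `e`: the normalizing factor of the Gibbs law with density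
proportional to `exp (-e (x, ·))` with respect to `Q`. -/
noncomputable def partitionFunction (Q : Measure β) (e : α × β → ℝ≥0∞) (x : α) : ℝ :=
  ∫ y, expNeg (e (x, y)) ∂Q

/-- The density with respect to `Q` of the Gibbs law of energy `e (x, ·)`. Where the partition
function vanishes it is set to `1`, so that it is a probability density for every `x`. -/
noncomputable def gibbsDensity (Q : Measure β) (e : α × β → ℝ≥0∞) (w : α × β) : ℝ≥0∞ :=
  ENNReal.ofReal
    (if partitionFunction Q e w.1 = 0 then 1 else expNeg (e w) / partitionFunction Q e w.1)

/-- The relative entropy with respect to `Q` of the Gibbs law with density proportional to `u`. -/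
noncomputable def gibbsRate (Q : Measure β) (u : β → ℝ) : ℝ :=
  -Real.log (∫ y, u y ∂Q) + (∫ y, u y * Real.log (u y) ∂Q) / ∫ y, u y ∂Q

variable {Q : Measure β} {e : α × β → ℝ≥0∞}

lemma partitionFunction_nonneg (x : α) : 0 ≤ partitionFunction Q e x :=
  integral_nonneg fun _ => expNeg_nonneg _

lemma toReal_gibbsDensity {w : α × β} (hw : 0 < partitionFunction Q e w.1) :
    (gibbsDensity Q e w).toReal = expNeg (e w) / partitionFunction Q e w.1 := by
  rw [gibbsDensity, if_neg hw.ne', ENNReal.toReal_ofReal (div_nonneg (expNeg_nonneg _) hw.le)]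

lemma gibbsDensity_lt_top (w : α × β) : gibbsDensity Q e w < ∞ := ENNReal.ofReal_lt_top

lemma gibbsDensity_ne_zero {w : α × β} (hw : 0 < partitionFunction Q e w.1) (he : e w ≠ ∞) :
    gibbsDensity Q e w ≠ 0 := by
  rw [gibbsDensity, if_neg hw.ne']
  exact (ENNReal.ofReal_pos.2 (div_pos (expNeg_pos he) hw)).ne'

lemma log_toReal_gibbsDensity {w : α × β} (hw : 0 < partitionFunction Q e w.1) (he : e w ≠ ∞) :
    Real.log (gibbsDensity Q e w).toReal
      = -(e w).toReal - Real.log (partitionFunction Q e w.1) := by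
  rw [toReal_gibbsDensity hw, Real.log_div (expNeg_pos he).ne' hw.ne', expNeg_of_ne_top he,
    Real.log_exp]

variable [MeasurableSpace α]

/-- The Gibbs channel: `x` is sent to the Gibbs law of energy `e (x, ·)` with base measure `Q`. -/
noncomputable def gibbsKernel (Q : Measure β) [SFinite Q] (e : α × β → ℝ≥0∞) : Kernel α β :=
  (Kernel.const α Q).withDensity fun x y => gibbsDensity Q e (x, y)

lemma integrable_expNeg_prodMk [IsFiniteMeasure Q] (he : Measurable e) (x : α) :
    Integrable (fun y => expNeg (e (x, y))) Q :=
  Integrable.of_bound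
    (measurable_expNeg.comp (he.comp measurable_prodMk_left)).aestronglyMeasurable 1 <|
    ae_of_all _ fun y => by
      rw [Real.norm_of_nonneg (expNeg_nonneg _)]
      exact expNeg_le_one _

lemma partitionFunction_le_one [IsProbabilityMeasure Q] (he : Measurable e) (x : α) :
    partitionFunction Q e x ≤ 1 := by
  simpa [partitionFunction] using
    integral_mono (integrable_expNeg_prodMk (Q := Q) he x) (integrable_const (1 : ℝ))
      fun y => expNeg_le_one _

lemma measurable_partitionFunction [SFinite Q] (he : Measurable e) :
    Measurable (partitionFunction Q e) := by
  have hu : StronglyMeasurable (Function.uncurry fun x y => expNeg (e (x, y))) :=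
    (measurable_expNeg.comp he).stronglyMeasurable
  exact (hu.integral_prod_right (ν := Q)).measurable

lemma measurable_partitionFunction_fst [SFinite Q] (he : Measurable e) :
    Measurable fun w : α × β => partitionFunction Q e w.1 :=
  (measurable_partitionFunction he).comp measurable_fst

lemma measurable_gibbsDensity [SFinite Q] (he : Measurable e) : Measurable (gibbsDensity Q e) :=
  (Measurable.ite (measurable_partitionFunction_fst he (measurableSet_singleton 0))
    measurable_const
    ((measurable_expNeg.comp he).div (measurable_partitionFunction_fst he))).ennreal_ofReal

lemma lintegral_gibbsDensity [IsProbabilityMeasure Q] (he : Measurable e) (x : α) :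
    ∫⁻ y, gibbsDensity Q e (x, y) ∂Q = 1 := by
  by_cases hx : partitionFunction Q e x = 0
  · simp [gibbsDensity, hx]
  · simp only [gibbsDensity, hx, if_false]
    rw [← ofReal_integral_eq_lintegral_ofReal ((integrable_expNeg_prodMk he x).div_const _)
        (ae_of_all _ fun y => div_nonneg (expNeg_nonneg _) (partitionFunction_nonneg x)),
      integral_div, ← partitionFunction, div_self hx, ENNReal.ofReal_one]

lemma isMarkovKernel_gibbsKernel [IsProbabilityMeasure Q] (he : Measurable e) :
    IsMarkovKernel (gibbsKernel Q e) := by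
  have hm : Measurable (Function.uncurry fun x y => gibbsDensity Q e (x, y)) :=
    measurable_gibbsDensity he
  refine ⟨fun x => ⟨?_⟩⟩
  rw [gibbsKernel, Kernel.withDensity_apply _ hm, Kernel.const_apply,
    withDensity_apply _ MeasurableSet.univ, Measure.restrict_univ, lintegral_gibbsDensity he]

variable {μ : Measure α}

lemma compProd_gibbsKernel [SFinite μ] [IsProbabilityMeasure Q] (he : Measurable e) :
    μ ⊗ₘ gibbsKernel Q e = (μ.prod Q).withDensity (gibbsDensity Q e) := by
  have : IsMarkovKernel ((Kernel.const α Q).withDensity fun x y => gibbsDensity Q e (x, y)) :=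
    isMarkovKernel_gibbsKernel he
  rw [gibbsKernel, ← Measure.compProd_const]
  exact Measure.compProd_withDensity (measurable_gibbsDensity he)

lemma ae_partitionFunction_pos [IsFiniteMeasure Q] {M : Measure (α × β)} (he : Measurable e)
    (hM : M ≪ μ.prod Q) (hfin : ∀ᵐ w ∂M, e w ≠ ∞) : ∀ᵐ w ∂M, 0 < partitionFunction Q e w.1 := by
  have htop : ∀ᵐ w ∂μ.prod Q, partitionFunction Q e w.1 = 0 → e w = ∞ := by
    rw [Measure.ae_prod_iff_ae_ae]
    · refine ae_of_all _ fun x => ?_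
      by_cases hx : partitionFunction Q e x = 0
      · filter_upwards [(integral_eq_zero_iff_of_nonneg (fun y => expNeg_nonneg _)
          (integrable_expNeg_prodMk he x)).1 hx] with y hy _
        by_contra h
        exact (expNeg_pos h).ne' hy
      · exact ae_of_all _ fun y h => absurd h hx
    · exact (measurable_partitionFunction_fst he (measurableSet_singleton 0)).imp
        (he (measurableSet_singleton ∞))
  filter_upwards [hM.ae_le htop, hfin] with w hw hew
  exact (partitionFunction_nonneg _).lt_of_ne fun h => hew (hw h.symm)

variable [IsFiniteMeasure μ] [IsProbabilityMeasure Q] {M : Measure (α × β)}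

lemma absolutelyContinuous_compProd_gibbsKernel (he : Measurable e)
    (hM : M ≪ μ.prod Q) (hfin : ∀ᵐ w ∂M, e w ≠ ∞) :
    M ≪ μ ⊗ₘ gibbsKernel Q e := by
  intro A hA
  rw [compProd_gibbsKernel he, withDensity_apply_eq_zero (measurable_gibbsDensity he),
    measure_eq_zero_iff_ae_notMem] at hA
  rw [measure_eq_zero_iff_ae_notMem]
  filter_upwards [hM.ae_le hA, ae_partitionFunction_pos he hM hfin, hfin] with w hw hpos hew hwA
  exact hw ⟨gibbsDensity_ne_zero hpos hew, hwA⟩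

lemma llr_prod_ae_eq_llr_gibbsKernel [IsFiniteMeasure M] (he : Measurable e)
    (hM : M ≪ μ.prod Q) (hfin : ∀ᵐ w ∂M, e w ≠ ∞) :
    llr M (μ.prod Q) =ᵐ[M] fun w => llr M (μ ⊗ₘ gibbsKernel Q e) w +
      (-(e w).toReal - Real.log (partitionFunction Q e w.1)) := by
  have hMN := absolutelyContinuous_compProd_gibbsKernel he hM hfin
  have := isMarkovKernel_gibbsKernel (Q := Q) he
  have hdens : (μ ⊗ₘ gibbsKernel Q e).rnDeriv (μ.prod Q) =ᵐ[μ.prod Q] gibbsDensity Q e := by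
    rw [compProd_gibbsKernel he]
    exact Measure.rnDeriv_withDensity _ (measurable_gibbsDensity he)
  filter_upwards [hM.ae_le (Measure.rnDeriv_mul_rnDeriv (κ := μ.prod Q) hMN), hM.ae_le hdens,
    Measure.rnDeriv_pos hMN, hMN.ae_le (Measure.rnDeriv_lt_top M _),
    ae_partitionFunction_pos he hM hfin, hfin] with w hchain hdens hpos hlt hZ hew
  have hd : (gibbsDensity Q e w).toReal ≠ 0 :=
    (ENNReal.toReal_pos (gibbsDensity_ne_zero hZ hew) (gibbsDensity_lt_top w).ne).ne'
  rw [llr, llr, ← log_toReal_gibbsDensity hZ hew, ← hchain, Pi.mul_apply, hdens,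
    ENNReal.toReal_mul, Real.log_mul (ENNReal.toReal_pos hpos.ne' hlt.ne).ne' hd]

end Gibbs

section GibbsVariational

open InformationTheory

lemma klDiv_prod_snd_le {α β : Type*} [MeasurableSpace α] [StandardBorelSpace α] [Nonempty α]
    [MeasurableSpace β] (N : Measure (α × β)) [IsProbabilityMeasure N] (μ : Measure α)
    [IsProbabilityMeasure μ] (Q : Measure β) [IsProbabilityMeasure Q] :
    klDiv N (μ.prod N.snd) ≤ klDiv N (μ.prod Q) := by
  have : IsProbabilityMeasure (N.map Prod.swap) :=
    Measure.isProbabilityMeasure_map measurable_swap.aemeasurable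
  have hdis : N.snd ⊗ₘ (N.map Prod.swap).condKernel = N.map Prod.swap := by
    rw [← Measure.fst_map_swap]
    exact Measure.disintegrate _ _
  have hchain := klDiv_compProd_eq_add N.snd Q (N.map Prod.swap).condKernel (Kernel.const β μ)
  rw [hdis, Measure.compProd_const, Measure.compProd_const] at hchain
  calc klDiv N (μ.prod N.snd)
      ≤ klDiv (N.map Prod.swap) (N.snd.prod μ) := by
        have := klDiv_map_le (N.map Prod.swap) (N.snd.prod μ) measurable_swap
        rwa [Measure.prod_swap, Measure.map_map measurable_swap measurable_swap,
          Prod.swap_swap_eq, Measure.map_id] at this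
    _ ≤ klDiv (N.map Prod.swap) (Q.prod μ) := hchain ▸ le_add_self
    _ ≤ klDiv N (μ.prod Q) := by
        rw [← Measure.prod_swap]
        exact klDiv_map_le _ _ measurable_swap

variable {α β : Type*} [MeasurableSpace α] [MeasurableSpace β] {μ : Measure α}
  [IsProbabilityMeasure μ] {Q : Measure β} [IsProbabilityMeasure Q] {e : α × β → ℝ≥0∞}
  {M : Measure (α × β)}

lemma measurePreserving_fst_compProd {μ : Measure α} [SFinite μ] (κ : Kernel α β)
    [IsMarkovKernel κ] : MeasurePreserving Prod.fst (μ ⊗ₘ κ) μ :=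
  ⟨measurable_fst, Measure.fst_compProd μ κ⟩

lemma integral_fst_compProd {μ : Measure α} [SFinite μ] {κ : Kernel α β} [IsMarkovKernel κ]
    {f : α → ℝ} (hf : AEStronglyMeasurable f μ) : ∫ w, f w.1 ∂(μ ⊗ₘ κ) = ∫ x, f x ∂μ := by
  have hmp := measurePreserving_fst_compProd (μ := μ) κ
  conv_rhs => rw [← hmp.map_eq]
  rw [integral_map measurable_fst.aemeasurable (by rwa [hmp.map_eq])]

lemma stronglyMeasurable_log_partitionFunction {Q : Measure β} [SFinite Q] (he : Measurable e) :
    StronglyMeasurable fun x => Real.log (partitionFunction Q e x) :=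
  (Real.measurable_log.comp (measurable_partitionFunction he)).stronglyMeasurable

lemma integrable_log_partitionFunction_fst [IsFiniteMeasure M] (he : Measurable e)
    (hM : M ≪ μ.prod Q) (hllr : Integrable (llr M (μ.prod Q)) M) (hei : ∫⁻ w, e w ∂M ≠ ∞) :
    Integrable (fun w => Real.log (partitionFunction Q e w.1)) M := by
  have := isMarkovKernel_gibbsKernel (Q := Q) he
  have hfin : ∀ᵐ w ∂M, e w ≠ ∞ := (ae_lt_top he hei).mono fun _ => LT.lt.ne
  have hMN := absolutelyContinuous_compProd_gibbsKernel he hM hfin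
  refine ((hllr.add (integrable_toReal_of_lintegral_ne_top he.aemeasurable hei)).add
    (Measure.integrable_toReal_rnDeriv (μ := μ ⊗ₘ gibbsKernel Q e) (ν := M))).mono'
    (Real.measurable_log.comp (measurable_partitionFunction_fst he)).aestronglyMeasurable ?_
  -- `-log Z = llr M (μ.prod Q) + e - llr M N`, and `-llr M N = log (dN/dM) ≤ dN/dM`
  filter_upwards [llr_prod_ae_eq_llr_gibbsKernel he hM hfin, neg_llr hMN,
    ae_partitionFunction_pos he hM hfin] with w hw hneg hpos
  have hlog := Real.log_le_self
    (ENNReal.toReal_nonneg (a := (μ ⊗ₘ gibbsKernel Q e).rnDeriv M w))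
  rw [Real.norm_eq_abs,
    abs_of_nonpos (Real.log_nonpos hpos.le (partitionFunction_le_one he w.1))]
  simp only [Pi.add_apply, Pi.neg_apply, llr] at hw hneg ⊢
  linarith

lemma integrable_and_integrable_of_integrable_llr_add {f : α → ℝ} {ν ρ : Measure α}
    [IsFiniteMeasure ν] [IsFiniteMeasure ρ] (hac : ν ≪ ρ) (hf : ∀ x, 0 ≤ f x) (hfm : Measurable f)
    (h : Integrable (fun x => llr ν ρ x + f x) ν) : Integrable (llr ν ρ) ν ∧ Integrable f ν := by
  have hfi : Integrable f ν := by
    refine (h.add (Measure.integrable_toReal_rnDeriv (μ := ρ) (ν := ν))).mono'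
      hfm.aestronglyMeasurable ?_
    filter_upwards [neg_llr hac] with x hneg
    have hlog := Real.log_le_self (ENNReal.toReal_nonneg (a := ρ.rnDeriv ν x))
    rw [Real.norm_of_nonneg (hf x)]
    simp only [Pi.add_apply, Pi.neg_apply, llr] at hneg ⊢
    linarith
  exact ⟨(h.sub hfi).congr (ae_of_all _ fun x => by simp), hfi⟩

lemma integrable_llr_compProd_gibbsKernel_iff [IsFiniteMeasure M] (he : Measurable e)
    (hM : M ≪ μ.prod Q) (hfin : ∀ᵐ w ∂M, e w ≠ ∞)
    (hlog : Integrable (fun w => Real.log (partitionFunction Q e w.1)) M) :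
    Integrable (llr M (μ ⊗ₘ gibbsKernel Q e)) M ↔
      Integrable (llr M (μ.prod Q)) M ∧ Integrable (fun w => (e w).toReal) M := by
  refine ⟨fun h => integrable_and_integrable_of_integrable_llr_add hM
    (fun _ => ENNReal.toReal_nonneg) he.ennreal_toReal ((h.sub hlog).congr ?_),
    fun h => ((h.1.add h.2).add hlog).congr ?_⟩ <;>
  · filter_upwards [llr_prod_ae_eq_llr_gibbsKernel he hM hfin] with w hw
    simp only [Pi.sub_apply, Pi.add_apply, hw]
    ring

theorem klDiv_prod_add_lintegral_eq [IsProbabilityMeasure M] (he : Measurable e)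
    (hM : M ≪ μ.prod Q) (hfin : ∀ᵐ w ∂M, e w ≠ ∞)
    (hlog : Integrable (fun w => Real.log (partitionFunction Q e w.1)) M) :
    klDiv M (μ.prod Q) + ∫⁻ w, e w ∂M = klDiv M (μ ⊗ₘ gibbsKernel Q e)
      + ENNReal.ofReal (-∫ w, Real.log (partitionFunction Q e w.1) ∂M) := by
  have := isMarkovKernel_gibbsKernel (Q := Q) he
  have hMN := absolutelyContinuous_compProd_gibbsKernel he hM hfin
  have hsplit := integrable_llr_compProd_gibbsKernel_iff he hM hfin hlog
  rw [integrable_toReal_iff he.aemeasurable hfin] at hsplit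
  by_cases h : Integrable (llr M (μ ⊗ₘ gibbsKernel Q e)) M
  · obtain ⟨hi, hE⟩ := hsplit.1 h
    have hei := (integrable_toReal_iff he.aemeasurable hfin).2 hE
    have hI := klDiv_ne_top_iff.2 ⟨hM, hi⟩
    have hJ := klDiv_ne_top_iff.2 ⟨hMN, h⟩
    have hlog0 : 0 ≤ -∫ w, Real.log (partitionFunction Q e w.1) ∂M := by
      rw [← integral_neg]
      exact integral_nonneg fun w => neg_nonneg.2 <|
        Real.log_nonpos (partitionFunction_nonneg _) (partitionFunction_le_one he _)
    rw [← ENNReal.toReal_eq_toReal_iff' (ENNReal.add_ne_top.2 ⟨hI, hE⟩)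
        (ENNReal.add_ne_top.2 ⟨hJ, ENNReal.ofReal_ne_top⟩), ENNReal.toReal_add hI hE,
      ENNReal.toReal_add hJ ENNReal.ofReal_ne_top, ENNReal.toReal_ofReal hlog0,
      toReal_klDiv_of_measure_eq hM (by simp), toReal_klDiv_of_measure_eq hMN (by simp),
      ← integral_toReal he.aemeasurable (ae_lt_top he hE), ← integral_add hi hei, ← sub_eq_add_neg,
      ← integral_sub h hlog]
    refine integral_congr_ae ?_
    filter_upwards [llr_prod_ae_eq_llr_gibbsKernel he hM hfin] with w hw
    rw [hw]
    ring
  · rw [klDiv_of_not_integrable h, top_add]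
    by_contra hne
    obtain ⟨hI, hE⟩ := ENNReal.add_ne_top.1 hne
    exact h (hsplit.2 ⟨(klDiv_ne_top_iff.1 hI).2, hE⟩)

/-! ### The relative entropy of the Gibbs channel -/

section GibbsChannel

variable (he : Measurable e) (hpos : ∀ᵐ x ∂μ, 0 < partitionFunction Q e x)
  (hlog : Integrable (fun x => Real.log (partitionFunction Q e x)) μ)
include he hpos

lemma ae_ne_top_compProd_gibbsKernel : ∀ᵐ w ∂(μ ⊗ₘ gibbsKernel Q e), e w ≠ ∞ := by
  have := isMarkovKernel_gibbsKernel (Q := Q) he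
  have hdens : ∀ᵐ w ∂(μ ⊗ₘ gibbsKernel Q e), gibbsDensity Q e w ≠ 0 := by
    rw [compProd_gibbsKernel he]
    exact (ae_withDensity_iff (measurable_gibbsDensity he)).2 (ae_of_all _ fun _ h => h)
  have hposN : ∀ᵐ w ∂(μ ⊗ₘ gibbsKernel Q e), 0 < partitionFunction Q e w.1 :=
    (measurePreserving_fst_compProd _).quasiMeasurePreserving.ae hpos
  filter_upwards [hposN, hdens] with w hw hdens htop
  exact hdens (by simp [gibbsDensity, hw.ne', htop])

include hlog

lemma klDiv_compProd_gibbsKernel_add_lintegral :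
    klDiv (μ ⊗ₘ gibbsKernel Q e) (μ.prod Q) + ∫⁻ w, e w ∂(μ ⊗ₘ gibbsKernel Q e) =
      ENNReal.ofReal (-∫ x, Real.log (partitionFunction Q e x) ∂μ) := by
  have := isMarkovKernel_gibbsKernel (Q := Q) he
  have hac : μ ⊗ₘ gibbsKernel Q e ≪ μ.prod Q := by
    rw [compProd_gibbsKernel he]
    exact withDensity_absolutelyContinuous _ _
  have hlogN : Integrable (fun w => Real.log (partitionFunction Q e w.1))
      (μ ⊗ₘ gibbsKernel Q e) :=
    (measurePreserving_fst_compProd _).integrable_comp_of_integrable hlog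
  rw [klDiv_prod_add_lintegral_eq he hac (ae_ne_top_compProd_gibbsKernel he hpos) hlogN,
    klDiv_self, zero_add,
    integral_fst_compProd (stronglyMeasurable_log_partitionFunction he).aestronglyMeasurable]

lemma toReal_klDiv_compProd_gibbsKernel :
    (klDiv (μ ⊗ₘ gibbsKernel Q e) (μ.prod Q)).toReal =
      ∫ x, gibbsRate Q (fun y => expNeg (e (x, y))) ∂μ := by
  have := isMarkovKernel_gibbsKernel (Q := Q) he
  have hcost := klDiv_compProd_gibbsKernel_add_lintegral he hpos hlog
  obtain ⟨hI, hE⟩ := ENNReal.add_ne_top.1 (hcost ▸ ENNReal.ofReal_ne_top)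
  have hei := integrable_toReal_of_lintegral_ne_top he.aemeasurable hE
  rw [compProd_gibbsKernel he, integrable_withDensity_iff_integrable_smul'
    (measurable_gibbsDensity he) (ae_of_all _ gibbsDensity_lt_top)] at hei
  have hinner : (fun x => ∫ y, (gibbsDensity Q e (x, y)).toReal • (e (x, y)).toReal ∂Q)
      =ᵐ[μ] fun x => -((∫ y, expNeg (e (x, y)) * Real.log (expNeg (e (x, y))) ∂Q) /
        partitionFunction Q e x) := by
    filter_upwards [hpos] with x hx
    simp only [expNeg_mul_log_expNeg, integral_neg, neg_div, neg_neg, ← integral_div]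
    refine integral_congr_ae (ae_of_all _ fun y => ?_)
    simp only [toReal_gibbsDensity (w := (x, y)) hx, smul_eq_mul]
    ring
  have henergy : (∫⁻ w, e w ∂(μ ⊗ₘ gibbsKernel Q e)).toReal =
      -∫ x, (∫ y, expNeg (e (x, y)) * Real.log (expNeg (e (x, y))) ∂Q) /
        partitionFunction Q e x ∂μ := by
    rw [← integral_toReal he.aemeasurable (ae_lt_top he hE), compProd_gibbsKernel he,
      integral_withDensity_eq_integral_toReal_smul (measurable_gibbsDensity he)
      (ae_of_all _ gibbsDensity_lt_top), integral_prod _ hei, integral_congr_ae hinner,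
      integral_neg]
  have hratio := (hei.integral_prod_left.congr hinner).neg
  have hlog0 : 0 ≤ -∫ x, Real.log (partitionFunction Q e x) ∂μ := by
    rw [← integral_neg]
    exact integral_nonneg fun x => neg_nonneg.2 <|
      Real.log_nonpos (partitionFunction_nonneg _) (partitionFunction_le_one he _)
  have hreal := congrArg ENNReal.toReal hcost
  rw [ENNReal.toReal_add hI hE, henergy, ENNReal.toReal_ofReal hlog0] at hreal
  have hadd := integral_add hlog.neg hratio
  simp only [Pi.neg_apply, neg_neg, integral_neg] at hadd
  calc (klDiv (μ ⊗ₘ gibbsKernel Q e) (μ.prod Q)).toReal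
      = _ := eq_add_of_add_neg_eq hreal
    _ = _ := hadd.symm

end GibbsChannel

theorem compProd_eq_compProd_gibbsKernel_of_isMinimizer [StandardBorelSpace α] [Nonempty α]
    {κ : Kernel α β} [IsMarkovKernel κ] (he : Measurable e)
    (hfin : klDiv (μ ⊗ₘ κ) (μ.prod (κ ∘ₘ μ)) + ∫⁻ w, e w ∂(μ ⊗ₘ κ) ≠ ∞)
    (hmin : ∀ κ' : Kernel α β, IsMarkovKernel κ' →
      klDiv (μ ⊗ₘ κ) (μ.prod (κ ∘ₘ μ)) + ∫⁻ w, e w ∂(μ ⊗ₘ κ) ≤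
        klDiv (μ ⊗ₘ κ') (μ.prod (κ' ∘ₘ μ)) + ∫⁻ w, e w ∂(μ ⊗ₘ κ')) :
    (∀ᵐ x ∂μ, 0 < partitionFunction (κ ∘ₘ μ) e x) ∧
    Integrable (fun x => Real.log (partitionFunction (κ ∘ₘ μ) e x)) μ ∧
    μ ⊗ₘ κ = μ ⊗ₘ gibbsKernel (κ ∘ₘ μ) e := by
  have hκ' := isMarkovKernel_gibbsKernel (Q := κ ∘ₘ μ) he
  have hmp := measurePreserving_fst_compProd (μ := μ) κ
  have hlogm := (stronglyMeasurable_log_partitionFunction (Q := κ ∘ₘ μ) he).aestronglyMeasurable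
    (μ := μ)
  obtain ⟨hI, hE⟩ := ENNReal.add_ne_top.1 hfin
  obtain ⟨hac, hllr⟩ := klDiv_ne_top_iff.1 hI
  have hefin : ∀ᵐ w ∂(μ ⊗ₘ κ), e w ≠ ∞ := (ae_lt_top he hE).mono fun _ => LT.lt.ne
  have hpos : ∀ᵐ x ∂μ, 0 < partitionFunction (κ ∘ₘ μ) e x := by
    have := (ae_map_iff hmp.measurable.aemeasurable (measurableSet_lt measurable_const
      (measurable_partitionFunction he))).2 (ae_partitionFunction_pos he hac hefin)
    rwa [hmp.map_eq] at this
  have hlogM := integrable_log_partitionFunction_fst he hac hllr hE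
  have hlog := (hmp.integrable_comp hlogm).1 hlogM
  refine ⟨hpos, hlog, klDiv_eq_zero_iff.1 (nonpos_iff_eq_zero.1 ?_)⟩
  have hle := calc
    klDiv (μ ⊗ₘ κ) (μ ⊗ₘ gibbsKernel (κ ∘ₘ μ) e)
        + ENNReal.ofReal (-∫ x, Real.log (partitionFunction (κ ∘ₘ μ) e x) ∂μ)
      = klDiv (μ ⊗ₘ κ) (μ.prod (κ ∘ₘ μ)) + ∫⁻ w, e w ∂(μ ⊗ₘ κ) := by
        rw [klDiv_prod_add_lintegral_eq he hac hefin hlogM,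
          integral_fst_compProd hlogm]
    _ ≤ _ := hmin _ hκ'
    _ ≤ klDiv (μ ⊗ₘ gibbsKernel (κ ∘ₘ μ) e) (μ.prod (κ ∘ₘ μ))
        + ∫⁻ w, e w ∂(μ ⊗ₘ gibbsKernel (κ ∘ₘ μ) e) := by
        gcongr
        have := klDiv_prod_snd_le (μ ⊗ₘ gibbsKernel (κ ∘ₘ μ) e) μ (κ ∘ₘ μ)
        rwa [Measure.snd_compProd] at this
    _ = 0 + ENNReal.ofReal (-∫ x, Real.log (partitionFunction (κ ∘ₘ μ) e x) ∂μ) := by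
        rw [klDiv_compProd_gibbsKernel_add_lintegral he hpos hlog, zero_add]
  exact (ENNReal.add_le_add_iff_right ENNReal.ofReal_ne_top).1 hle

end GibbsVariational

/-! ### Stability of the Gibbs rate -/

section GibbsRate

variable {β : Type*} [MeasurableSpace β] {Q : Measure β}

lemma exists_abs_mul_log_le (C : ℝ) : ∃ B, ∀ t, |t| ≤ C → |t * Real.log t| ≤ B := by
  obtain ⟨B, hB⟩ := (isCompact_Icc (a := -C) (b := C)).exists_bound_of_continuousOn
    Real.continuous_mul_log.continuousOn
  exact ⟨B, fun t ht => hB t (abs_le.1 ht)⟩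

lemma gibbsRate_map {Ω : Type*} [MeasurableSpace Ω] {μ : Measure Ω} {T : Ω → β}
    (hT : AEMeasurable T μ) {u : β → ℝ} (hu : Measurable u) :
    gibbsRate (μ.map T) u = gibbsRate μ (u ∘ T) := by
  have hulog : Measurable fun y => u y * Real.log (u y) := hu.mul hu.log
  simp only [gibbsRate, Function.comp_apply, integral_map hT hu.aestronglyMeasurable,
    integral_map hT hulog.aestronglyMeasurable]

lemma measurable_gibbsRate {α : Type*} [MeasurableSpace α] [SFinite Q] {U : α → β → ℝ}
    (hU : Measurable (Function.uncurry U)) : Measurable fun x => gibbsRate Q (U x) := by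
  have hmass : Measurable fun x => ∫ y, U x y ∂Q :=
    (hU.stronglyMeasurable.integral_prod_right (ν := Q)).measurable
  have hmulLog : Measurable fun x => ∫ y, U x y * Real.log (U x y) ∂Q :=
    ((hU.mul hU.log).stronglyMeasurable.integral_prod_right (ν := Q)).measurable
  exact hmass.log.neg.add (hmulLog.div hmass)

section Finite

variable [IsFiniteMeasure Q]

lemma integrable_of_mem_Icc {u : β → ℝ} (hu : AEStronglyMeasurable u Q) {C : ℝ}
    (huC : ∀ y, u y ∈ Set.Icc 0 C) : Integrable u Q :=
  Integrable.of_bound hu C <| ae_of_all _ fun y =>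
    (abs_of_nonneg (huC y).1).trans_le (huC y).2

lemma integrable_mul_log {u : β → ℝ} (hu : AEStronglyMeasurable u Q) {C : ℝ}
    (huC : ∀ y, u y ∈ Set.Icc 0 C) : Integrable (fun y => u y * Real.log (u y)) Q := by
  obtain ⟨B, hB⟩ := exists_abs_mul_log_le C
  exact Integrable.of_bound (Real.continuous_mul_log.comp_aestronglyMeasurable hu) B <|
    ae_of_all _ fun y => hB _ ((abs_of_nonneg (huC y).1).trans_le (huC y).2)

lemma gibbsRate_le {u : β → ℝ} (hu : AEStronglyMeasurable u Q) {C : ℝ}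
    (huC : ∀ y, u y ∈ Set.Icc 0 C) (hpos : 0 < ∫ y, u y ∂Q) :
    gibbsRate Q u ≤ Real.log C - Real.log (∫ y, u y ∂Q) := by
  have hpointwise : ∀ y, u y * Real.log (u y) ≤ Real.log C * u y := fun y => by
    rcases (huC y).1.eq_or_lt with h | h
    · simp [← h]
    · rw [mul_comm]
      exact mul_le_mul_of_nonneg_right (Real.log_le_log h (huC y).2) h.le
  have hmean : ∫ y, u y * Real.log (u y) ∂Q ≤ Real.log C * ∫ y, u y ∂Q := by
    rw [← integral_const_mul]
    exact integral_mono (integrable_mul_log hu huC)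
      ((integrable_of_mem_Icc hu huC).const_mul _) hpointwise
  rw [gibbsRate, neg_add_eq_sub]
  exact sub_le_sub_right ((div_le_iff₀ hpos).2 hmean) _

lemma tendsto_gibbsRate {u : ℕ → β → ℝ} {v : β → ℝ} (hu : ∀ n, AEStronglyMeasurable (u n) Q)
    {C : ℝ} (hC : ∀ n y, |u n y| ≤ C) (hlim : ∀ᵐ y ∂Q, Tendsto (fun n => u n y) atTop (𝓝 (v y)))
    (hpos : 0 < ∫ y, v y ∂Q) :
    Tendsto (fun n => gibbsRate Q (u n)) atTop (𝓝 (gibbsRate Q v)) := by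
  obtain ⟨B, hB⟩ := exists_abs_mul_log_le C
  have hmass : Tendsto (fun n => ∫ y, u n y ∂Q) atTop (𝓝 (∫ y, v y ∂Q)) :=
    tendsto_integral_of_dominated_convergence (fun _ => C) hu (integrable_const _)
      (fun n => ae_of_all _ (hC n)) hlim
  have hmulLog : Tendsto (fun n => ∫ y, u n y * Real.log (u n y) ∂Q) atTop
      (𝓝 (∫ y, v y * Real.log (v y) ∂Q)) :=
    tendsto_integral_of_dominated_convergence (fun _ => B)
      (fun n => Real.continuous_mul_log.comp_aestronglyMeasurable (hu n)) (integrable_const _)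
      (fun n => ae_of_all _ fun y => hB _ (hC n y))
      (hlim.mono fun y hy => (Real.continuous_mul_log.tendsto _).comp hy)
  exact (hmass.log hpos.ne').neg.add (hmulLog.div hmass hpos.ne')

end Finite

variable [IsProbabilityMeasure Q]

lemma gibbsRate_nonneg {u : β → ℝ} (hu : AEStronglyMeasurable u Q) {C : ℝ}
    (huC : ∀ y, u y ∈ Set.Icc 0 C) : 0 ≤ gibbsRate Q u := by
  have hjensen := Real.convexOn_mul_log.map_integral_le Real.continuous_mul_log.continuousOn
    isClosed_Ici (ae_of_all _ fun y => (huC y).1) (integrable_of_mem_Icc hu huC)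
    (integrable_mul_log hu huC)
  rcases (integral_nonneg fun y => (huC y).1 : 0 ≤ ∫ y, u y ∂Q).eq_or_lt with hmass | hmass
  · simp [gibbsRate, ← hmass]
  · rw [gibbsRate, neg_add_eq_sub, sub_nonneg, le_div_iff₀ hmass, mul_comm]
    exact hjensen

lemma exp_neg_mul_mem_Icc (lam : ℝ) {t C : ℝ} (ht : |t| ≤ C) :
    Real.exp (-lam * t) ∈ Set.Icc (Real.exp (-(|lam| * C))) (Real.exp (|lam| * C)) := by
  have habs : |-lam * t| ≤ |lam| * C := by
    rw [abs_mul, abs_neg]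
    exact mul_le_mul_of_nonneg_left ht (abs_nonneg _)
  exact ⟨Real.exp_le_exp.2 (abs_le.1 habs).1, Real.exp_le_exp.2 (abs_le.1 habs).2⟩

lemma exp_le_integral_exp_neg_mul (lam : ℝ) {g : β → ℝ} (hg : AEStronglyMeasurable g Q) {C : ℝ}
    (hC : ∀ᵐ y ∂Q, |g y| ≤ C) : Real.exp (-(|lam| * C)) ≤ ∫ y, Real.exp (-lam * g y) ∂Q := by
  have hint : Integrable (fun y => Real.exp (-lam * g y)) Q :=
    Integrable.of_bound (Real.continuous_exp.comp_aestronglyMeasurable (hg.const_mul _))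
      (Real.exp (|lam| * C)) <| hC.mono fun y hy =>
        (abs_of_pos (Real.exp_pos _)).trans_le (exp_neg_mul_mem_Icc lam hy).2
  simpa using integral_mono_ae (integrable_const _) hint
    (hC.mono fun y hy => (exp_neg_mul_mem_Icc lam hy).1)

lemma abs_gibbsRate_exp_neg_mul_le (lam : ℝ) {g : β → ℝ} (hg : AEStronglyMeasurable g Q) {C : ℝ}
    (hC : ∀ y, |g y| ≤ C) :
    |gibbsRate Q fun y => Real.exp (-lam * g y)| ≤ |lam| * C + |lam| * C := by
  have hu : AEStronglyMeasurable (fun y => Real.exp (-lam * g y)) Q :=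
    Real.continuous_exp.comp_aestronglyMeasurable (hg.const_mul _)
  have huC : ∀ y, Real.exp (-lam * g y) ∈ Set.Icc 0 (Real.exp (|lam| * C)) := fun y =>
    ⟨(Real.exp_pos _).le, (exp_neg_mul_mem_Icc lam (hC y)).2⟩
  have hmass := exp_le_integral_exp_neg_mul lam hg (ae_of_all _ hC)
  have hle := gibbsRate_le hu huC ((Real.exp_pos _).trans_le hmass)
  have hlog := Real.log_le_log (Real.exp_pos _) hmass
  rw [Real.log_exp] at hle hlog
  rw [abs_of_nonneg (gibbsRate_nonneg hu huC)]
  linarith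

variable {α : Type*} [MeasurableSpace α] {μ : Measure α}

/-- The rate, for input law `μ` and base law `Q`, of the Gibbs channel whose density is
proportional to `exp (-lam * g x y)`. -/
noncomputable def meanGibbsRate (lam : ℝ) (μ : Measure α) (Q : Measure β) (g : α → β → ℝ) : ℝ :=
  ∫ x, gibbsRate Q (fun y => Real.exp (-lam * g x y)) ∂μ

lemma measurable_uncurry_exp_neg_mul (lam : ℝ) {g : α → β → ℝ}
    (hg : Measurable (Function.uncurry g)) :
    Measurable (Function.uncurry fun x y => Real.exp (-lam * g x y)) :=
  (hg.const_mul (-lam)).exp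

lemma tendsto_meanGibbsRate [IsFiniteMeasure μ] (lam : ℝ) {G : ℕ → α → β → ℝ} {g : α → β → ℝ}
    (hG : ∀ n, Measurable (Function.uncurry (G n))) {C : ℝ} (hC : ∀ n x y, |G n x y| ≤ C)
    (hlim : ∀ᵐ x ∂μ, ∀ᵐ y ∂Q, Tendsto (fun n => G n x y) atTop (𝓝 (g x y))) :
    Tendsto (fun n => meanGibbsRate lam μ Q (G n)) atTop (𝓝 (meanGibbsRate lam μ Q g)) := by
  have hGx : ∀ n x, AEStronglyMeasurable (G n x) Q := fun n x =>
    ((hG n).comp measurable_prodMk_left).aestronglyMeasurable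
  refine tendsto_integral_of_dominated_convergence (fun _ => |lam| * C + |lam| * C)
    (fun n => (measurable_gibbsRate
      (measurable_uncurry_exp_neg_mul lam (hG n))).aestronglyMeasurable)
    (integrable_const _)
    (fun n => ae_of_all _ fun x => abs_gibbsRate_exp_neg_mul_le lam (hGx n x) (hC n x)) ?_
  filter_upwards [hlim] with x hx
  have hg : AEStronglyMeasurable (g x) Q := aestronglyMeasurable_of_tendsto_ae atTop (hGx · x) hx
  have hgC : ∀ᵐ y ∂Q, |g x y| ≤ C :=
    hx.mono fun y hy => le_of_tendsto' hy.abs fun n => hC n x y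
  refine tendsto_gibbsRate (C := Real.exp (|lam| * C))
    (fun n => Real.continuous_exp.comp_aestronglyMeasurable ((hGx n x).const_mul _))
    (fun n y => (abs_of_pos (Real.exp_pos _)).trans_le (exp_neg_mul_mem_Icc lam (hC n x y)).2)
    (hx.mono fun y hy => (Real.continuous_exp.tendsto _).comp (hy.const_mul _))
    ((Real.exp_pos _).trans_le (exp_le_integral_exp_neg_mul lam hg hgC))

/-- The truncation of an extended nonnegative number at level `n`, as a real number. -/
noncomputable def truncate (n : ℕ) (a : ℝ≥0∞) : ℝ := (min a n).toReal

lemma measurable_truncate (n : ℕ) : Measurable (truncate n) :=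
  (measurable_id.min measurable_const).ennreal_toReal

lemma truncate_nonneg (n : ℕ) (a : ℝ≥0∞) : 0 ≤ truncate n a := ENNReal.toReal_nonneg

lemma abs_truncate_le (n : ℕ) (a : ℝ≥0∞) : |truncate n a| ≤ n := by
  rw [abs_of_nonneg (truncate_nonneg n a)]
  exact ENNReal.toReal_mono (ENNReal.natCast_ne_top n) (min_le_right a n)

lemma truncate_top (n : ℕ) : truncate n ∞ = n := by simp [truncate]

lemma truncate_of_le {n : ℕ} {a : ℝ≥0∞} (ha : a ≤ n) : truncate n a = a.toReal := by
  rw [truncate, min_eq_left ha]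

section Truncate

variable {lam : ℝ}

lemma expNeg_ofReal_mul (hlam : 0 ≤ lam) {a : ℝ≥0∞} (ha : a ≠ ∞) :
    expNeg (ENNReal.ofReal lam * a) = Real.exp (-lam * a.toReal) := by
  rw [expNeg_of_ne_top (ENNReal.mul_ne_top ENNReal.ofReal_ne_top ha), ENNReal.toReal_mul,
    ENNReal.toReal_ofReal hlam, neg_mul]

lemma expNeg_ofReal_mul_top (hlam : 0 < lam) : expNeg (ENNReal.ofReal lam * ∞) = 0 := by
  rw [ENNReal.mul_top (ENNReal.ofReal_pos.2 hlam).ne', expNeg_top]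

lemma expNeg_ofReal_mul_le (hlam : 0 < lam) (n : ℕ) (a : ℝ≥0∞) :
    expNeg (ENNReal.ofReal lam * a) ≤ Real.exp (-lam * truncate n a) := by
  by_cases ha : a = ∞
  · rw [ha, expNeg_ofReal_mul_top hlam]
    positivity
  · rw [expNeg_ofReal_mul hlam.le ha]
    exact Real.exp_le_exp.2 <| mul_le_mul_of_nonpos_left
      (ENNReal.toReal_mono ha (min_le_left a n)) (neg_nonpos.2 hlam.le)

lemma exp_neg_mul_truncate_mem_Icc (hlam : 0 ≤ lam) (n : ℕ) (a : ℝ≥0∞) :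
    Real.exp (-lam * truncate n a) ∈ Set.Icc 0 1 :=
  ⟨(Real.exp_pos _).le, Real.exp_le_one_iff.2 <|
    mul_nonpos_of_nonpos_of_nonneg (neg_nonpos.2 hlam) (truncate_nonneg n a)⟩

lemma tendsto_exp_neg_mul_truncate (hlam : 0 < lam) (a : ℝ≥0∞) :
    Tendsto (fun n => Real.exp (-lam * truncate n a)) atTop
      (𝓝 (expNeg (ENNReal.ofReal lam * a))) := by
  by_cases ha : a = ∞
  · simp only [ha, expNeg_ofReal_mul_top hlam, truncate_top]
    exact Real.tendsto_exp_atBot.comp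
      (tendsto_natCast_atTop_atTop.const_mul_atTop_of_neg (neg_neg_of_pos hlam))
  · obtain ⟨N, hN⟩ := ENNReal.exists_nat_gt ha
    refine tendsto_const_nhds.congr' ?_
    filter_upwards [eventually_ge_atTop N] with n hn
    rw [expNeg_ofReal_mul hlam.le ha, truncate_of_le (hN.le.trans (Nat.cast_le.2 hn))]

variable {D : α × β → ℝ≥0∞}

lemma gibbsRate_truncate_mem_Icc (hlam : 0 < lam) (hD : Measurable D) (n : ℕ) {x : α}
    (hx : 0 < partitionFunction Q (fun w => ENNReal.ofReal lam * D w) x) :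
    gibbsRate Q (fun y => Real.exp (-lam * truncate n (D (x, y)))) ∈
      Set.Icc 0 (-Real.log (partitionFunction Q (fun w => ENNReal.ofReal lam * D w) x)) := by
  have hu : AEStronglyMeasurable (fun y => Real.exp (-lam * truncate n (D (x, y)))) Q :=
    (((measurable_truncate n).comp
      (hD.comp measurable_prodMk_left)).const_mul _).exp.aestronglyMeasurable
  have huC : ∀ y, Real.exp (-lam * truncate n (D (x, y))) ∈ Set.Icc 0 1 := fun y =>
    exp_neg_mul_truncate_mem_Icc hlam.le n _
  have hmass : partitionFunction Q (fun w => ENNReal.ofReal lam * D w) x ≤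
      ∫ y, Real.exp (-lam * truncate n (D (x, y))) ∂Q :=
    integral_mono (integrable_expNeg_prodMk (hD.const_mul _) x) (integrable_of_mem_Icc hu huC)
      fun y => expNeg_ofReal_mul_le hlam n _
  refine ⟨gibbsRate_nonneg hu huC, (gibbsRate_le hu huC (hx.trans_le hmass)).trans ?_⟩
  rw [Real.log_one, zero_sub]
  exact neg_le_neg (Real.log_le_log hx hmass)

lemma tendsto_meanGibbsRate_truncate (hlam : 0 < lam) (hD : Measurable D)
    (hpos : ∀ᵐ x ∂μ, 0 < partitionFunction Q (fun w => ENNReal.ofReal lam * D w) x)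
    (hlog : Integrable
      (fun x => Real.log (partitionFunction Q (fun w => ENNReal.ofReal lam * D w) x)) μ) :
    Tendsto (fun n => meanGibbsRate lam μ Q fun x y => truncate n (D (x, y))) atTop
      (𝓝 (∫ x, gibbsRate Q (fun y => expNeg (ENNReal.ofReal lam * D (x, y))) ∂μ)) := by
  have hmeas : ∀ n, Measurable (Function.uncurry fun x y => truncate n (D (x, y))) := fun n =>
    (measurable_truncate n).comp hD
  refine tendsto_integral_of_dominated_convergence _
    (fun n => (measurable_gibbsRate
      (measurable_uncurry_exp_neg_mul lam (hmeas n))).aestronglyMeasurable)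
    hlog.neg (fun n => hpos.mono fun x hx => ?_) (hpos.mono fun x hx => ?_)
  · obtain ⟨hnonneg, hle⟩ := gibbsRate_truncate_mem_Icc hlam hD n hx
    exact (abs_of_nonneg hnonneg).trans_le hle
  · exact tendsto_gibbsRate
      (fun n => (((hmeas n).comp measurable_prodMk_left).const_mul _).exp.aestronglyMeasurable)
      (fun n y => (abs_of_pos (Real.exp_pos _)).trans_le
        (exp_neg_mul_truncate_mem_Icc hlam.le n _).2)
      (ae_of_all _ fun y => tendsto_exp_neg_mul_truncate hlam _) hx

end Truncate

end GibbsRate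

/-! ### Uniform laws of large numbers -/

lemma IsSquashing.uniformContinuous {σ : ℝ → ℝ} (hσ : IsSquashing σ) : UniformContinuous σ := by
  -- `σ` has the same limits as the clamp function, so their difference vanishes at infinity.
  let clamp : ℝ → ℝ := fun t => max 0 (min 1 t)
  have hclamp : UniformContinuous clamp :=
    ((LipschitzWith.id.const_min 1).const_max 0).uniformContinuous
  have hbot : Tendsto clamp atBot (𝓝 0) := by
    refine tendsto_const_nhds.congr' ?_
    filter_upwards [eventually_le_atBot 0] with t ht
    exact (max_eq_left (min_le_of_right_le ht)).symm
  have htop : Tendsto clamp atTop (𝓝 1) := by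
    refine tendsto_const_nhds.congr' ?_
    filter_upwards [eventually_ge_atTop 1] with t ht
    simp only [clamp, min_eq_left ht, max_eq_right zero_le_one]
  have hdiff : UniformContinuous fun t => σ t - clamp t := by
    refine (hσ.continuous.sub hclamp.continuous).uniformContinuous_of_tendsto_cocompact (x := 0) ?_
    rw [cocompact_eq_atBot_atTop, tendsto_sup]
    exact ⟨by simpa using hσ.tendsto_atBot.sub hbot, by simpa using hσ.tendsto_atTop.sub htop⟩
  simpa using hdiff.add hclamp

lemma ridge_uniformContinuous {σ : ℝ → ℝ} (hσ : IsSquashing σ) {V : Type*} [AddCommGroup V]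
    [Module ℝ V] [UniformSpace V] [IsUniformAddGroup V] :
    ∀ f ∈ ridge σ V, UniformContinuous f := by
  intro f hf
  induction hf using Submodule.span_induction with
  | mem f hf =>
    obtain ⟨u, rfl⟩ := hf
    exact hσ.uniformContinuous.comp (u.1.uniformContinuous.add uniformContinuous_const)
  | zero => exact uniformContinuous_const
  | add f g _ _ hf hg => exact hf.add hg
  | smul c f _ hf => exact hf.const_smul c

lemma exists_continuous_slice {𝒳 𝒴 E : Type*} [PseudoMetricSpace 𝒳] [PseudoMetricSpace 𝒴]
    [NormedAddCommGroup E] {H : 𝒳 → 𝒴 → E} (hH : UniformContinuous (Function.uncurry H)) {C : ℝ}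
    (hC : ∀ x y, ‖H x y‖ ≤ C) :
    ∃ Φ : 𝒴 → BoundedContinuousFunction 𝒳 E,
      Continuous Φ ∧ (∀ y, ‖Φ y‖ ≤ |C|) ∧ ∀ y x, Φ y x = H x y := by
  refine ⟨fun y => BoundedContinuousFunction.ofNormedAddCommGroup (fun x => H x y)
    (hH.continuous.comp (Continuous.prodMk_left y)) |C| fun x => (hC x y).trans (le_abs_self C),
    ?_, fun y => BoundedContinuousFunction.norm_ofNormedAddCommGroup_le _ (abs_nonneg C) _,
    fun y x => rfl⟩
  refine Metric.continuous_iff.2 fun y₀ η hη => ?_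
  obtain ⟨δ, hδ, h⟩ := Metric.uniformContinuous_iff.1 hH (η / 2) (half_pos hη)
  refine ⟨δ, hδ, fun y hy => lt_of_le_of_lt
    ((BoundedContinuousFunction.dist_le (half_pos hη).le).2 fun x =>
      (h (a := (x, y)) (b := (x, y₀)) ?_).le) (half_lt_self hη)⟩
  rw [Prod.dist_eq, dist_self]
  exact max_lt hδ hy

section UniformLaw

variable {𝒳 𝒴 E Ω : Type*} [MeasurableSpace 𝒴] [NormedAddCommGroup E] [NormedSpace ℝ E]
  [CompleteSpace E] [MeasurableSpace Ω] {μ : Measure Ω} {Q : Measure 𝒴} {Y : ℕ → Ω → 𝒴}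

/-- The uniform law is the strong law in the Banach space of bounded continuous functions. -/
lemma ae_tendstoUniformly_average_boundedContinuous [TopologicalSpace 𝒳]
    {Φ : 𝒴 → BoundedContinuousFunction 𝒳 E} (hΦ : StronglyMeasurable Φ) (hint : Integrable Φ Q)
    (hlaw : ∀ j, HasLaw (Y j) Q μ) (hind : Pairwise fun i j => Y i ⟂ᵢ[μ] Y j) :
    ∀ᵐ ω ∂μ, TendstoUniformly
      (fun (m : ℕ) x => (m : ℝ)⁻¹ • ∑ j ∈ Finset.range m, Φ (Y j ω) x)
      (fun x => ∫ y, Φ y x ∂Q) atTop := by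
  borelize (BoundedContinuousFunction 𝒳 E)
  have hlaw₀ := (hlaw 0).map_eq
  have hstrong := strong_law_ae (μ := μ) (fun j => Φ ∘ Y j)
    ((hlaw₀ ▸ hint).comp_aemeasurable (hlaw 0).aemeasurable)
    (fun i j hij => (hind hij).comp hΦ.measurable hΦ.measurable)
    (fun j => ((hlaw j).identDistrib (hlaw 0)).comp hΦ.measurable)
  have hmean : ∫ ω, (Φ ∘ Y 0) ω ∂μ = ∫ y, Φ y ∂Q :=
    (hlaw 0).integral_comp hΦ.aestronglyMeasurable
  filter_upwards [hstrong] with ω hω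
  rw [hmean, BoundedContinuousFunction.tendsto_iff_tendstoUniformly] at hω
  convert hω using 1
  · ext m x
    simp
  · ext x
    exact (BoundedContinuousFunction.evalCLM ℝ x).integral_comp_comm hint

variable [PseudoMetricSpace 𝒳] [PseudoMetricSpace 𝒴]

lemma ae_tendstoUniformly_average [SecondCountableTopology 𝒴] [BorelSpace 𝒴] [IsFiniteMeasure Q]
    {H : 𝒳 → 𝒴 → E} (hH : UniformContinuous (Function.uncurry H)) {C : ℝ}
    (hC : ∀ x y, ‖H x y‖ ≤ C) (hlaw : ∀ j, HasLaw (Y j) Q μ)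
    (hind : Pairwise fun i j => Y i ⟂ᵢ[μ] Y j) :
    ∀ᵐ ω ∂μ, TendstoUniformly
      (fun (m : ℕ) x => (m : ℝ)⁻¹ • ∑ j ∈ Finset.range m, H x (Y j ω))
      (fun x => ∫ y, H x y ∂Q) atTop := by
  obtain ⟨Φ, hΦ, hΦC, hΦH⟩ := exists_continuous_slice hH hC
  have hint : Integrable Φ Q :=
    Integrable.of_bound hΦ.stronglyMeasurable.aestronglyMeasurable |C| (ae_of_all _ hΦC)
  simpa only [hΦH] using
    ae_tendstoUniformly_average_boundedContinuous hΦ.stronglyMeasurable hint hlaw hind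

end UniformLaw

/-! ### Consistency of the empirical rate -/

/-- The pair `(u, u log u)`, whose two means determine the Gibbs rate of the density `u`. -/
noncomputable def gibbsMoments (u : ℝ) : ℝ × ℝ := (u, u * Real.log u)

/-- The Gibbs rate as a function of the mean of `gibbsMoments`. -/
noncomputable def rateOfMoments (w : ℝ × ℝ) : ℝ := -Real.log w.1 + w.2 / w.1

/-- The contribution of the observation `x` to the empirical rate: the rate of the Gibbs density
`exp (-lam * g x ·)` with respect to the empirical law of `y 0, …, y (m - 1)`. -/
noncomputable def empRate {𝒳 𝒴 : Type*} (lam : ℝ) (g : 𝒳 → 𝒴 → ℝ) (y : ℕ → 𝒴) (m : ℕ) (x : 𝒳) :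
    ℝ :=
  rateOfMoments ((m : ℝ)⁻¹ • ∑ j ∈ Finset.range m, gibbsMoments (Real.exp (-lam * g x (y j))))

lemma empR_eq_average {𝒳 𝒴 𝒵 : Type*} (lam : ℝ) (g : 𝒳 → 𝒴 → ℝ) (T : 𝒵 → 𝒴) (x : ℕ → 𝒳)
    (z : ℕ → 𝒵) (n : ℕ) {m : ℕ} (hm : m ≠ 0) :
    empR lam g T x z n m =
      (n : ℝ)⁻¹ • ∑ i ∈ Finset.range n, empRate lam g (T ∘ z) m (x i) := by
  have hrate : ∀ i, empRate lam g (T ∘ z) m (x i) =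
      -Real.log ((1 / (m : ℝ)) * ∑ j ∈ Finset.range m, Real.exp (-lam * g (x i) (T (z j)))) -
      lam * ∑ j ∈ Finset.range m, g (x i) (T (z j)) * (Real.exp (-lam * g (x i) (T (z j))) /
        ∑ j' ∈ Finset.range m, Real.exp (-lam * g (x i) (T (z j')))) := fun i => by
    simp only [empRate, rateOfMoments, gibbsMoments, Function.comp_apply, Real.log_exp,
      Prod.smul_fst, Prod.smul_snd, Prod.fst_sum, Prod.snd_sum, smul_eq_mul]
    rw [mul_div_mul_left _ _ (by positivity : (m : ℝ)⁻¹ ≠ 0), sub_eq_add_neg, Finset.sum_div,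
      ← neg_mul, one_div, Finset.mul_sum (a := -lam)]
    congr 1
    exact Finset.sum_congr rfl fun j _ => by ring
  simp only [hrate, empR, empL, empD, Finset.sum_sub_distrib, Finset.sum_neg_distrib,
    ← Finset.mul_sum, smul_eq_mul]
  ring

lemma average_mem {E : Type*} [AddCommGroup E] [Module ℝ E] {K : Set E} (hK : Convex ℝ K)
    {f : ℕ → E} (hf : ∀ j, f j ∈ K) {m : ℕ} (hm : m ≠ 0) :
    (m : ℝ)⁻¹ • ∑ j ∈ Finset.range m, f j ∈ K := by
  rw [Finset.smul_sum]
  exact hK.sum_mem (fun _ _ => by positivity)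
    (by simp [Nat.cast_ne_zero.2 hm]) fun j _ => hf j

lemma tendsto_average_of_tendstoUniformly {𝒳 : Type*} {f : ℕ → 𝒳 → ℝ} {r : 𝒳 → ℝ}
    (hf : TendstoUniformly f r atTop) {x : ℕ → 𝒳} {a : ℝ}
    (hr : Tendsto (fun n : ℕ => (n : ℝ)⁻¹ • ∑ i ∈ Finset.range n, r (x i)) atTop (𝓝 a)) :
    Tendsto (fun nm : ℕ × ℕ => (nm.1 : ℝ)⁻¹ • ∑ i ∈ Finset.range nm.1, f nm.2 (x i)) atTop
      (𝓝 a) := by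
  have hdiff : Tendsto (fun nm : ℕ × ℕ =>
      (nm.1 : ℝ)⁻¹ • ∑ i ∈ Finset.range nm.1, (f nm.2 (x i) - r (x i))) atTop (𝓝 0) := by
    rw [← prod_atTop_atTop_eq]
    refine Metric.tendsto_nhds.2 fun η hη => ?_
    filter_upwards [(eventually_ne_atTop 0).prod_mk
      (Metric.tendstoUniformly_iff.1 hf (η / 2) (half_pos hη))] with nm ⟨hn, hm⟩
    refine (Metric.mem_closedBall.1 (average_mem (convex_closedBall 0 (η / 2)) (fun i => ?_)
      hn)).trans_lt (half_lt_self hη)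
    rw [mem_closedBall_zero_iff, ← dist_eq_norm, dist_comm]
    exact (hm (x i)).le
  have hmain : Tendsto (fun nm : ℕ × ℕ =>
      (nm.1 : ℝ)⁻¹ • ∑ i ∈ Finset.range nm.1, r (x i)) atTop (𝓝 a) := by
    rw [← prod_atTop_atTop_eq]
    exact hr.comp tendsto_fst
  simpa only [Finset.sum_sub_distrib, smul_sub, sub_add_cancel, zero_add] using hdiff.add hmain

lemma gibbsRate_eq_rateOfMoments {β : Type*} [MeasurableSpace β] {Q : Measure β} {u : β → ℝ}
    (hu : Integrable u Q) (hulog : Integrable (fun y => u y * Real.log (u y)) Q) :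
    gibbsRate Q u = rateOfMoments (∫ y, gibbsMoments (u y) ∂Q) := by
  simp only [gibbsMoments, integral_pair hu hulog, gibbsRate, rateOfMoments]

lemma continuous_gibbsMoments : Continuous gibbsMoments :=
  continuous_id.prodMk Real.continuous_mul_log

lemma uniformContinuousOn_rateOfMoments {c : ℝ} (hc : 0 < c) (A B : ℝ) :
    UniformContinuousOn rateOfMoments (Set.Icc c A ×ˢ Set.Icc (-B) B) := by
  refine (isCompact_Icc.prod isCompact_Icc).uniformContinuousOn_of_continuous ?_
  have hne : ∀ w ∈ Set.Icc c A ×ˢ Set.Icc (-B) B, w.1 ≠ 0 := fun w hw =>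
    (hc.trans_le hw.1.1).ne'
  exact (continuousOn_fst.log hne).neg.add (continuousOn_snd.div continuousOn_fst hne)

lemma exists_gibbsMoments_exp_mem (lam C : ℝ) :
    ∃ A B, ∀ t, |t| ≤ C →
      gibbsMoments (Real.exp (-lam * t)) ∈
        Set.Icc (Real.exp (-(|lam| * C))) A ×ˢ Set.Icc (-B) B := by
  obtain ⟨B, hB⟩ := exists_abs_mul_log_le (Real.exp (|lam| * C))
  refine ⟨Real.exp (|lam| * C), B, fun t ht => ⟨exp_neg_mul_mem_Icc lam ht, ?_⟩⟩
  exact abs_le.1 (hB _ ((abs_of_pos (Real.exp_pos _)).trans_le (exp_neg_mul_mem_Icc lam ht).2))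

section Consistency

variable {𝒳 𝒴 Ω : Type*} [PseudoMetricSpace 𝒳] [PseudoMetricSpace 𝒴] [SecondCountableTopology 𝒴]
  [MeasurableSpace 𝒴] [BorelSpace 𝒴] [MeasurableSpace Ω] {μ : Measure Ω} {Q : Measure 𝒴}
  [IsProbabilityMeasure Q] {Y : ℕ → Ω → 𝒴} {g : 𝒳 → 𝒴 → ℝ}

lemma ae_tendstoUniformly_average_gibbsMoments (lam : ℝ)
    (hg : UniformContinuous (Function.uncurry g)) {C : ℝ} (hC : ∀ x y, |g x y| ≤ C)
    (hlaw : ∀ j, HasLaw (Y j) Q μ) (hind : Pairwise fun i j => Y i ⟂ᵢ[μ] Y j) :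
    ∀ᵐ ω ∂μ, TendstoUniformly
      (fun (m : ℕ) x => (m : ℝ)⁻¹ • ∑ j ∈ Finset.range m,
        gibbsMoments (Real.exp (-lam * g x (Y j ω))))
      (fun x => ∫ y, gibbsMoments (Real.exp (-lam * g x y)) ∂Q) atTop := by
  have hφ : Continuous fun t => gibbsMoments (Real.exp (-lam * t)) :=
    continuous_gibbsMoments.comp (by fun_prop)
  obtain ⟨B, hB⟩ := (isCompact_Icc (a := -C) (b := C)).exists_bound_of_continuousOn
    hφ.continuousOn
  have hunif : UniformContinuous
      (Function.uncurry fun x y => gibbsMoments (Real.exp (-lam * g x y))) :=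
    uniformContinuousOn_univ.1 <|
      (isCompact_Icc.uniformContinuousOn_of_continuous hφ.continuousOn).comp
        hg.uniformContinuousOn fun w _ => abs_le.1 (hC w.1 w.2)
  exact ae_tendstoUniformly_average hunif (fun x y => hB _ (abs_le.1 (hC x y))) hlaw hind

lemma ae_tendstoUniformly_empRate (lam : ℝ) (hg : UniformContinuous (Function.uncurry g)) {C : ℝ}
    (hC : ∀ x y, |g x y| ≤ C) (hlaw : ∀ j, HasLaw (Y j) Q μ)
    (hind : Pairwise fun i j => Y i ⟂ᵢ[μ] Y j) :
    ∀ᵐ ω ∂μ, TendstoUniformly (fun m x => empRate lam g (Y · ω) m x)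
      (fun x => gibbsRate Q fun y => Real.exp (-lam * g x y)) atTop := by
  obtain ⟨A, B, hK⟩ := exists_gibbsMoments_exp_mem lam C
  filter_upwards [ae_tendstoUniformly_average_gibbsMoments lam hg hC hlaw hind] with ω hω
  have hmem : ∀ᶠ m : ℕ in atTop, ∀ x, (m : ℝ)⁻¹ • ∑ j ∈ Finset.range m,
      gibbsMoments (Real.exp (-lam * g x (Y j ω))) ∈
        Set.Icc (Real.exp (-(|lam| * C))) A ×ˢ Set.Icc (-B) B := by
    filter_upwards [eventually_ne_atTop 0] with m hm x
    exact average_mem ((convex_Icc _ _).prod (convex_Icc _ _)) (fun j => hK _ (hC x _)) hm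
  have hmem_lim : ∀ x, ∫ y, gibbsMoments (Real.exp (-lam * g x y)) ∂Q ∈
      Set.Icc (Real.exp (-(|lam| * C))) A ×ˢ Set.Icc (-B) B := fun x =>
    (isClosed_Icc.prod isClosed_Icc).mem_of_tendsto (hω.tendsto_at x) (hmem.mono fun m hm => hm x)
  have hrate : ∀ x, gibbsRate Q (fun y => Real.exp (-lam * g x y)) =
      rateOfMoments (∫ y, gibbsMoments (Real.exp (-lam * g x y)) ∂Q) := fun x => by
    have hgx : AEStronglyMeasurable (fun y => Real.exp (-lam * g x y)) Q :=
      Continuous.aestronglyMeasurable <| Real.continuous_exp.comp <|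
        (hg.continuous.comp (Continuous.prodMk_right x)).const_mul (-lam)
    have hu : ∀ y, Real.exp (-lam * g x y) ∈ Set.Icc 0 (Real.exp (|lam| * C)) := fun y =>
      ⟨(Real.exp_pos _).le, (exp_neg_mul_mem_Icc lam (hC x y)).2⟩
    exact gibbsRate_eq_rateOfMoments (integrable_of_mem_Icc hgx hu) (integrable_mul_log hgx hu)
  simpa only [hrate, empRate] using
    (uniformContinuousOn_rateOfMoments (Real.exp_pos _) A B).comp_tendstoUniformly_eventually
      hmem hmem_lim hω

theorem ae_tendsto_empR {𝒵 : Type*} [SecondCountableTopology 𝒳] [MeasurableSpace 𝒳]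
    [BorelSpace 𝒳] [MeasurableSpace 𝒵] {P : Measure 𝒳} [IsFiniteMeasure P] {PZ : Measure 𝒵}
    [IsProbabilityMeasure PZ] {X : ℕ → Ω → 𝒳} {Z : ℕ → Ω → 𝒵} {T : 𝒵 → 𝒴} (hT : Measurable T)
    (lam : ℝ) (hg : UniformContinuous (Function.uncurry g)) {C : ℝ} (hC : ∀ x y, |g x y| ≤ C)
    (hX : ∀ i, HasLaw (X i) P μ) (hXind : Pairwise fun i j => X i ⟂ᵢ[μ] X j)
    (hZ : ∀ j, HasLaw (Z j) PZ μ) (hZind : Pairwise fun i j => Z i ⟂ᵢ[μ] Z j) :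
    ∀ᵐ ω ∂μ, Tendsto (fun nm : ℕ × ℕ => empR lam g T (X · ω) (Z · ω) nm.1 nm.2) atTop
      (𝓝 (meanGibbsRate lam P (PZ.map T) g)) := by
  have : IsProbabilityMeasure (PZ.map T) := Measure.isProbabilityMeasure_map hT.aemeasurable
  set r : 𝒳 → ℝ := fun x => gibbsRate (PZ.map T) fun y => Real.exp (-lam * g x y)
  have hr : Measurable r :=
    measurable_gibbsRate (measurable_uncurry_exp_neg_mul lam hg.continuous.measurable)
  have hrint : Integrable r P := Integrable.of_bound hr.aestronglyMeasurable _ <| ae_of_all _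
    fun x => abs_gibbsRate_exp_neg_mul_le lam
      (hg.continuous.comp (Continuous.prodMk_right x)).aestronglyMeasurable (hC x)
  have hlln : ∀ᵐ ω ∂μ, Tendsto (fun n : ℕ => (n : ℝ)⁻¹ • ∑ i ∈ Finset.range n, r (X i ω)) atTop
      (𝓝 (meanGibbsRate lam P (PZ.map T) g)) := by
    have hmean : ∫ ω, (r ∘ X 0) ω ∂μ = meanGibbsRate lam P (PZ.map T) g :=
      (hX 0).integral_comp hr.aestronglyMeasurable
    rw [← hmean]
    exact strong_law_ae (fun i => r ∘ X i)
      (((hX 0).map_eq ▸ hrint).comp_aemeasurable (hX 0).aemeasurable)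
      (fun i j hij => (hXind hij).comp hr hr)
      (fun i => ((hX i).identDistrib (hX 0)).comp hr)
  have hY : ∀ j, HasLaw (T ∘ Z j) (PZ.map T) μ := fun j =>
    HasLaw.comp ⟨hT.aemeasurable, rfl⟩ (hZ j)
  filter_upwards [hlln, ae_tendstoUniformly_empRate lam hg hC hY
    fun i j hij => (hZind hij).comp hT hT] with ω hrate hunif
  refine (tendsto_average_of_tendstoUniformly hunif hrate).congr' ?_
  rw [← prod_atTop_atTop_eq]
  filter_upwards [tendsto_snd.eventually (eventually_ne_atTop 0)] with nm hm
  exact (empR_eq_average lam g T _ _ _ hm).symm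

end Consistency

/-! ### Network approximation of a transport map -/

lemma tendsto_eLpNorm_one_sub {α : Type*} [MeasurableSpace α] {μ : Measure α} [IsFiniteMeasure μ]
    {t : ℕ → α → ℝ} {s f : α → ℝ} (ht : ∀ n, Measurable (t n)) (hf : Measurable f) {B C : ℝ}
    (hB : ∀ n x, |t n x| ≤ B) (hC : ∀ x, |f x| ≤ C)
    (hlim : ∀ x, Tendsto (fun n => t n x) atTop (𝓝 (s x))) :
    Tendsto (fun n => eLpNorm (t n - f) 1 μ) atTop (𝓝 (eLpNorm (s - f) 1 μ)) := by
  have hbound : ∀ n x, ‖(t n - f) x‖ₑ ≤ ENNReal.ofReal (B + C) := fun n x => by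
    rw [← ofReal_norm]
    exact ENNReal.ofReal_le_ofReal ((abs_sub _ _).trans (add_le_add (hB n x) (hC x)))
  simp only [eLpNorm_one_eq_lintegral_enorm]
  exact tendsto_lintegral_of_dominated_convergence (fun _ => ENNReal.ofReal (B + C))
    (fun n => ((ht n).sub hf).enorm) (fun n => ae_of_all _ (hbound n))
    (by simpa using ENNReal.mul_ne_top ENNReal.ofReal_ne_top (measure_ne_top μ _))
    (ae_of_all _ fun x => ((hlim x).sub_const _).enorm)

section Density

variable {ι : Type*} [Countable ι] {σ : ℝ → ℝ}

lemma BddClosure.measurable_of_ridge (hσ : IsSquashing σ) {f : (ι → ℝ) → ℝ}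
    (hf : BddClosure (ridge σ (ι → ℝ) : Set ((ι → ℝ) → ℝ)) f) : Measurable f :=
  hf.measurable fun g hg => (ridge_uniformContinuous hσ g hg).continuous.measurable

variable {μ : Measure (ι → ℝ)} [IsFiniteMeasure μ]

lemma exists_ridge_eLpNorm_sub_lt (hσ : IsSquashing σ) {f : (ι → ℝ) → ℝ} (hf : Measurable f)
    {C : ℝ} (hC : ∀ x, |f x| ≤ C) {η : ℝ≥0∞} (hη : 0 < η) :
    ∃ t ∈ ridge σ (ι → ℝ), eLpNorm (t - f) 1 μ < η := by
  refine BddClosure.exists_mem_of_open (fun t => eLpNorm (t - f) 1 μ < η) ?_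
    (ridge_closure_measurable hσ hf hC) (by simpa using hη)
  intro t s B ht htB hlim hs
  exact ((tendsto_eLpNorm_one_sub (fun n => (ht n).measurable_of_ridge hσ) hf htB hC
    hlim).eventually_lt_const hs).exists

lemma exists_ridge_tendsto_ae (hσ : IsSquashing σ) {f : (ι → ℝ) → ℝ} (hf : Measurable f) :
    ∃ t : ℕ → (ι → ℝ) → ℝ, (∀ n, t n ∈ ridge σ (ι → ℝ)) ∧
      ∀ᵐ x ∂μ, Tendsto (fun n => t n x) atTop (𝓝 (f x)) := by
  let clamp : ℕ → (ι → ℝ) → ℝ := fun n x => max (-(n : ℝ)) (min n (f x))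
  have hclampm : ∀ n, Measurable (clamp n) := fun n =>
    measurable_const.max (measurable_const.min hf)
  have hclampC : ∀ n x, |clamp n x| ≤ n := fun n x =>
    abs_le.2 ⟨le_max_left _ _, max_le (by simp) (min_le_left _ _)⟩
  have hclamp : ∀ x, Tendsto (fun n => clamp n x) atTop (𝓝 (f x)) := fun x => by
    refine tendsto_const_nhds.congr' ?_
    filter_upwards [tendsto_natCast_atTop_atTop.eventually_ge_atTop |f x|] with n hn
    simp only [clamp, min_eq_right (abs_le.1 hn).2, max_eq_right (abs_le.1 hn).1]
  choose t ht htη using fun n : ℕ =>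
    exists_ridge_eLpNorm_sub_lt hσ (μ := μ) (hclampm n) (hclampC n)
      (ENNReal.inv_pos.2 (ENNReal.natCast_ne_top n))
  have hdiff : Tendsto (fun n => eLpNorm (t n - clamp n - 0) 1 μ) atTop (𝓝 0) := by
    simp only [sub_zero]
    exact tendsto_of_tendsto_of_tendsto_of_le_of_le tendsto_const_nhds
      ENNReal.tendsto_inv_nat_nhds_zero (fun _ => zero_le) fun n => (htη n).le
  obtain ⟨φ, hφ, hae⟩ := (tendstoInMeasure_of_tendsto_eLpNorm one_ne_zero
    (fun n => (((ridge_uniformContinuous hσ _ (ht n)).continuous.measurable.sub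
      (hclampm n)).aestronglyMeasurable)) aestronglyMeasurable_zero hdiff).exists_seq_tendsto_ae
  refine ⟨t ∘ φ, fun n => ht _, hae.mono fun x hx => ?_⟩
  simpa using hx.add ((hclamp x).comp hφ.tendsto_atTop)

lemma exists_ridge_tendsto_ae_pi {κ : Type*} [Countable κ] (hσ : IsSquashing σ)
    {T : (ι → ℝ) → κ → ℝ} (hT : Measurable T) :
    ∃ t : ℕ → (ι → ℝ) → κ → ℝ, (∀ n o, (t n · o) ∈ ridge σ (ι → ℝ)) ∧
      ∀ᵐ x ∂μ, Tendsto (fun n => t n x) atTop (𝓝 (T x)) := by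
  choose t ht hlim using fun o : κ =>
    exists_ridge_tendsto_ae hσ (μ := μ) ((measurable_pi_apply o).comp hT)
  exact ⟨fun n x o => t o n x, fun n o => ht o n,
    (ae_all_iff.2 hlim).mono fun x hx => tendsto_pi_nhds.2 hx⟩

end Density

lemma tendsto_levyProkhorovEDist_map {α β : Type*} [MeasurableSpace α] [PseudoMetricSpace β]
    [SecondCountableTopology β] [MeasurableSpace β] [BorelSpace β] {μ : Measure α}
    [IsProbabilityMeasure μ] {T : ℕ → α → β} {T₀ : α → β} (hT : ∀ n, AEMeasurable (T n) μ)
    (hT₀ : AEMeasurable T₀ μ) (hlim : ∀ᵐ x ∂μ, Tendsto (fun n => T n x) atTop (𝓝 (T₀ x))) :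
    Tendsto (fun n => levyProkhorovEDist (μ.map (T n)) (μ.map T₀)) atTop (𝓝 0) :=
  tendsto_iff_edist_tendsto_0.1 <|
    (LevyProkhorov.continuous_ofMeasure_probabilityMeasure.tendsto _).comp
      (tendstoInDistribution_of_ae_tendsto hT hT₀ hlim).tendsto

lemma meanGibbsRate_map {α β γ : Type*} [MeasurableSpace α] [MeasurableSpace β]
    [MeasurableSpace γ] (lam : ℝ) {μ : Measure α} {ν : Measure γ} {T : γ → β}
    (hT : AEMeasurable T ν) {g : α → β → ℝ} (hg : Measurable (Function.uncurry g)) :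
    meanGibbsRate lam μ (ν.map T) g = meanGibbsRate lam μ ν fun x z => g x (T z) := by
  refine integral_congr_ae (ae_of_all _ fun x => gibbsRate_map hT ?_)
  exact (measurable_uncurry_exp_neg_mul lam hg).comp measurable_prodMk_left

theorem exists_ridge_transport {α ι κ : Type*} [Countable ι] [Fintype κ] [TopologicalSpace α]
    [MeasurableSpace α] [BorelSpace α] [SecondCountableTopology α] {σ : ℝ → ℝ}
    (hσ : IsSquashing σ)
    (PZ : Measure (ι → ℝ)) [IsProbabilityMeasure PZ] [NullSingletonClass PZ]
    (Q : Measure (κ → ℝ)) [IsProbabilityMeasure Q] (μ : Measure α) [IsFiniteMeasure μ] (lam : ℝ)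
    {g : α → (κ → ℝ) → ℝ} (hg : Continuous (Function.uncurry g)) {B : ℝ}
    (hB : ∀ x y, |g x y| ≤ B) {δ : ℝ≥0∞} (hδ : 0 < δ) {η : ℝ} (hη : 0 < η) :
    ∃ T : (ι → ℝ) → κ → ℝ, (∀ o, (T · o) ∈ ridge σ (ι → ℝ)) ∧
      levyProkhorovEDist (PZ.map T) Q < δ ∧
      |meanGibbsRate lam μ (PZ.map T) g - meanGibbsRate lam μ Q g| < η := by
  obtain ⟨T₀, hT₀, rfl⟩ := exists_measurable_transport PZ Q
  obtain ⟨T, hT, hlim⟩ := exists_ridge_tendsto_ae_pi hσ (μ := PZ) hT₀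
  have hTm : ∀ n, Measurable (T n) := fun n => measurable_pi_lambda _ fun o =>
    (ridge_uniformContinuous hσ _ (hT n o)).continuous.measurable
  have hrate : Tendsto (fun n => meanGibbsRate lam μ (PZ.map (T n)) g) atTop
      (𝓝 (meanGibbsRate lam μ (PZ.map T₀) g)) := by
    simp only [meanGibbsRate_map lam (hTm _).aemeasurable hg.measurable,
      meanGibbsRate_map lam hT₀.aemeasurable hg.measurable]
    refine tendsto_meanGibbsRate lam
      (fun n => hg.measurable.comp (measurable_fst.prodMk ((hTm n).comp measurable_snd)))
      (fun n x z => hB x (T n z)) (ae_of_all _ fun x => hlim.mono fun z hz => ?_)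
    exact ((hg.comp (Continuous.prodMk_right x)).tendsto _).comp hz
  have hlaw := tendsto_levyProkhorovEDist_map (fun n => (hTm n).aemeasurable) hT₀.aemeasurable hlim
  obtain ⟨n, hn, hn'⟩ := ((hlaw.eventually_lt_const hδ).and
    (Metric.tendsto_nhds.1 hrate η hη)).exists
  exact ⟨T n, hT n, hn, hn'⟩

/-! ### Network approximation of the distortion measure -/

lemma closeTo_of_abs_sub_truncate_lt {ε t : ℝ} {a : ℝ≥0∞} {n : ℕ} (hn : 1 / ε + 1 ≤ n)
    (ha : a ≠ ∞ → a ≤ n) (h : |t - truncate n a| < min ε 1) : CloseTo ε t a := by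
  refine ⟨fun hfin => ?_, fun htop => ?_⟩
  · rw [truncate_of_le (ha hfin)] at h
    exact h.le.trans (min_le_left _ _)
  · rw [htop, truncate_top] at h
    linarith [(abs_lt.1 h).1, min_le_right ε 1]

section Estimator

variable {W : Type*} [MeasurableSpace W] {μ : Measure W} {D : W → ℝ≥0∞}

lemma tendsto_measure_natCast_lt [IsFiniteMeasure μ] (hD : Measurable D) :
    Tendsto (fun n : ℕ => μ {w | (n : ℝ≥0∞) < D w ∧ D w ≠ ∞}) atTop (𝓝 0) := by
  have hempty : ⋂ n : ℕ, {w | (n : ℝ≥0∞) < D w ∧ D w ≠ ∞} = ∅ := by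
    refine Set.eq_empty_of_forall_notMem fun w hw => ?_
    obtain ⟨n, hn⟩ := ENNReal.exists_nat_gt (Set.mem_iInter.1 hw 0).2
    exact hn.not_gt (Set.mem_iInter.1 hw n).1
  rw [← measure_empty (μ := μ), ← hempty]
  exact tendsto_measure_iInter_atTop
    (fun n => ((measurableSet_lt measurable_const hD).inter
      (hD (measurableSet_singleton ∞).compl)).nullMeasurableSet)
    (fun m n hmn w hw => ⟨(Nat.cast_le.2 hmn).trans_lt hw.1, hw.2⟩) ⟨0, measure_ne_top _ _⟩

lemma measure_not_closeTo_le {ε : ℝ} (hε : 0 < ε) {n : ℕ} (hn : 1 / ε + 1 ≤ n)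
    (htail : μ {w | (n : ℝ≥0∞) < D w ∧ D w ≠ ∞} ≤ ENNReal.ofReal (ε / 2)) {G : W → ℝ}
    (hmeas : AEStronglyMeasurable (G - truncate n ∘ D) μ)
    (hG : eLpNorm (G - truncate n ∘ D) 1 μ ≤ ENNReal.ofReal (min ε 1 * (ε / 2))) :
    μ {w | ¬ CloseTo ε (G w) (D w)} ≤ ENNReal.ofReal ε := by
  have hδ : 0 < min ε 1 := lt_min hε one_pos
  have hsub : {w | ¬ CloseTo ε (G w) (D w)} ⊆ {w | (n : ℝ≥0∞) < D w ∧ D w ≠ ∞} ∪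
      {w | ENNReal.ofReal (min ε 1) ≤ ‖(G - truncate n ∘ D) w‖ₑ} := by
    intro w hw
    contrapose! hw
    simp only [Set.mem_union, Set.mem_ofPred_eq, not_or, not_and, not_le, ← ofReal_norm,
      ENNReal.ofReal_lt_ofReal_iff hδ] at hw
    exact not_not.2 <| closeTo_of_abs_sub_truncate_lt hn
      (fun hfin => not_lt.1 fun h => hw.1 h hfin) hw.2
  have hmarkov : μ {w | ENNReal.ofReal (min ε 1) ≤ ‖(G - truncate n ∘ D) w‖ₑ} ≤
      ENNReal.ofReal (ε / 2) := by
    have h := mul_meas_ge_le_pow_eLpNorm' μ one_ne_zero ENNReal.one_ne_top hmeas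
      (ENNReal.ofReal (min ε 1))
    simp only [ENNReal.toReal_one, ENNReal.rpow_one] at h
    rw [ENNReal.ofReal_mul hδ.le] at hG
    exact (ENNReal.mul_le_mul_iff_right (ENNReal.ofReal_pos.2 hδ).ne' ENNReal.ofReal_ne_top).1
      (h.trans hG)
  calc μ {w | ¬ CloseTo ε (G w) (D w)}
      ≤ ENNReal.ofReal (ε / 2) + ENNReal.ofReal (ε / 2) :=
        (measure_mono hsub).trans <| (measure_union_le _ _).trans (add_le_add htail hmarkov)
    _ = ENNReal.ofReal ε := by
      rw [← ENNReal.ofReal_add (by positivity) (by positivity), add_halves]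

end Estimator

section RateApproximation

variable {α β ι : Type*} [MeasurableSpace α] [MeasurableSpace β] [Countable ι] {σ : ℝ → ℝ}
  {μ : Measure α} [IsFiniteMeasure μ] {Q : Measure β} [IsProbabilityMeasure Q]
  {e : α × β → ι → ℝ}

lemma exists_ridge_eLpNorm_sub_lt_and_meanGibbsRate_sub_lt (hσ : IsSquashing σ)
    (he : MeasurableEmbedding e) (lam : ℝ) {h : α × β → ℝ} (hh : Measurable h) {C : ℝ}
    (hC : ∀ w, |h w| ≤ C) {δ : ℝ≥0∞} (hδ : 0 < δ) {η : ℝ} (hη : 0 < η) :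
    ∃ G ∈ ridge σ (ι → ℝ), eLpNorm (G ∘ e - h) 1 (μ.prod Q) < δ ∧
      |meanGibbsRate lam μ Q (fun x y => G (e (x, y))) -
        meanGibbsRate lam μ Q fun x y => h (x, y)| < η := by
  obtain ⟨f, hf, hfC, rfl⟩ : ∃ f : (ι → ℝ) → ℝ, Measurable f ∧ (∀ v, |f v| ≤ |C|) ∧ f ∘ e = h := by
    obtain ⟨F, hF, rfl⟩ := he.exists_measurable_extend hh fun _ => ⟨0⟩
    refine ⟨fun v => max (-|C|) (min |C| (F v)), measurable_const.max (measurable_const.min hF),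
      fun v => abs_le.2 ⟨le_max_left _ _, max_le (by simp) (min_le_left _ _)⟩, funext fun w => ?_⟩
    obtain ⟨hlow, hupp⟩ := abs_le.1 ((hC w).trans (le_abs_self C))
    exact (congrArg _ (min_eq_right hupp)).trans (max_eq_right hlow)
  refine BddClosure.exists_mem_of_open (fun G => eLpNorm (G ∘ e - f ∘ e) 1 (μ.prod Q) < δ ∧
    |meanGibbsRate lam μ Q (fun x y => G (e (x, y))) -
      meanGibbsRate lam μ Q fun x y => f (e (x, y))| < η) ?_
    (ridge_closure_measurable hσ hf hfC) (by simpa using And.intro hδ hη)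
  rintro F G B hF hB hlim ⟨hGδ, hGη⟩
  have hFe : ∀ n, Measurable (F n ∘ e) := fun n =>
    ((hF n).measurable_of_ridge hσ).comp he.measurable
  have hnorm := tendsto_eLpNorm_one_sub (μ := μ.prod Q) (s := G ∘ e) hFe hh
    (fun n w => hB n (e w)) hC fun w => hlim (e w)
  have hrate := tendsto_meanGibbsRate (μ := μ) (Q := Q) lam (G := fun n x y => F n (e (x, y)))
    (g := fun x y => G (e (x, y))) hFe (fun n x y => hB n _)
    (ae_of_all _ fun x => ae_of_all _ fun y => hlim _)
  exact ((hnorm.eventually_lt_const hGδ).and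
    ((hrate.sub_const _).abs.eventually_lt_const hGη)).exists

theorem exists_ridge_estimator (hσ : IsSquashing σ) (he : MeasurableEmbedding e) {lam R : ℝ}
    {D : α × β → ℝ≥0∞} (hD : Measurable D)
    (hR : Tendsto (fun n => meanGibbsRate lam μ Q fun x y => truncate n (D (x, y))) atTop (𝓝 R))
    {ε η : ℝ} (hε : 0 < ε) (hη : 0 < η) :
    ∃ G ∈ ridge σ (ι → ℝ), μ.prod Q {w | ¬ CloseTo ε (G (e w)) (D w)} ≤ ENNReal.ofReal ε ∧
      |meanGibbsRate lam μ Q (fun x y => G (e (x, y))) - R| < η := by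
  have htail := (tendsto_measure_natCast_lt (μ := μ.prod Q) hD).eventually_lt_const
    (ENNReal.ofReal_pos.2 (half_pos hε))
  obtain ⟨n, hn, hntail, hnR⟩ :=
    ((tendsto_natCast_atTop_atTop.eventually_ge_atTop (1 / ε + 1)).and
      (htail.and (Metric.tendsto_nhds.1 hR (η / 2) (half_pos hη)))).exists
  have hδ : 0 < ENNReal.ofReal (min ε 1 * (ε / 2)) :=
    ENNReal.ofReal_pos.2 (mul_pos (lt_min hε one_pos) (half_pos hε))
  have hm : Measurable (truncate n ∘ D) := (measurable_truncate n).comp hD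
  obtain ⟨G, hG, hGδ, hGη⟩ := exists_ridge_eLpNorm_sub_lt_and_meanGibbsRate_sub_lt (μ := μ) (Q := Q)
    hσ he lam hm (fun w => abs_truncate_le n _) hδ (half_pos hη)
  have hGe : Measurable (G ∘ e) :=
    (ridge_uniformContinuous hσ G hG).continuous.measurable.comp he.measurable
  refine ⟨G, hG, measure_not_closeTo_le hε hn hntail.le (hGe.sub hm).aestronglyMeasurable hGδ.le,
    ?_⟩
  calc _ ≤ _ := abs_sub_le _ _ _
    _ < η / 2 + η / 2 := add_lt_add hGη hnR
    _ = η := add_halves η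

end RateApproximation

/-! ### The rate at an optimal channel -/

section Optimal

variable {p : ℕ} {S Y : Type*} [MeasurableSpace S] [StandardBorelSpace S] [Nonempty S]
  [MeasurableSpace Y] {P : Measure ((Fin p → ℝ) × S)} {d : S × Y → ℝ≥0∞} {lam : ℝ}
  {κ : Kernel (Fin p → ℝ) Y}

instance [IsProbabilityMeasure P] [IsMarkovKernel κ] : IsProbabilityMeasure (reproLaw P.fst κ) :=
  inferInstanceAs (IsProbabilityMeasure (κ ∘ₘ P.fst))

section FiniteMeasure

variable [IsFiniteMeasure P]

lemma measurable_dbar (hd : Measurable d) :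
    Measurable fun w : (Fin p → ℝ) × Y => dbar P d w.1 w.2 :=
  Measurable.lintegral_kernel_prod_right (κ := P.condKernel.comap Prod.fst measurable_fst)
    (f := fun w s => d (s, w.2))
    (hd.comp (measurable_snd.prodMk (measurable_snd.comp measurable_fst)))

lemma expDistortion_eq_lintegral_compProd (hd : Measurable d) [IsSFiniteKernel κ] :
    expDistortion P d κ = ∫⁻ w, dbar P d w.1 w.2 ∂(P.fst ⊗ₘ κ) :=
  (Measure.lintegral_compProd (measurable_dbar hd)).symm

lemma lagrangian_eq (hd : Measurable d) [IsSFiniteKernel κ] :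
    lagrangian P d lam κ = InformationTheory.klDiv (P.fst ⊗ₘ κ) (P.fst.prod (κ ∘ₘ P.fst)) +
      ∫⁻ w, ENNReal.ofReal lam * dbar P d w.1 w.2 ∂(P.fst ⊗ₘ κ) := by
  rw [lintegral_const_mul _ (measurable_dbar hd), ← expDistortion_eq_lintegral_compProd hd]
  rfl

lemma iRDF_eq_mutualInfo [IsMarkovKernel κ] (hκ : IsOptimalChannel P d lam κ) :
    iRDF P d (expDistortion P d κ) = mutualInfo P.fst κ := by
  have hfin : ENNReal.ofReal lam * expDistortion P d κ ≠ ∞ := (ENNReal.add_ne_top.1 hκ.1).2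
  refine le_antisymm (iInf_le_of_le κ (iInf_le_of_le inferInstance (iInf_le _ le_rfl))) ?_
  refine le_iInf fun κ' => le_iInf fun hκ' => le_iInf fun hD => ?_
  exact (ENNReal.add_le_add_iff_right hfin).1 <|
    (hκ.2 κ' hκ').trans (add_le_add_right (mul_le_mul_right hD _) _)

lemma iRDF_ne_top [IsMarkovKernel κ] (hκ : IsOptimalChannel P d lam κ) :
    iRDF P d (expDistortion P d κ) ≠ ∞ :=
  iRDF_eq_mutualInfo hκ ▸ (ENNReal.add_ne_top.1 hκ.1).1

end FiniteMeasure

variable [IsProbabilityMeasure P] [IsMarkovKernel κ]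

lemma mutualInfo_eq_zero_of_isOptimalChannel_zero (hκ : IsOptimalChannel P d 0 κ) :
    mutualInfo P.fst κ = 0 := by
  have hle := hκ.2 (Kernel.const _ (reproLaw P.fst κ)) inferInstance
  simp only [lagrangian, ENNReal.ofReal_zero, zero_mul, add_zero] at hle
  refine le_antisymm (hle.trans_eq ?_) zero_le
  simp only [mutualInfo, reproLaw, Measure.compProd_const, Measure.const_comp, measure_univ,
    one_smul, InformationTheory.klDiv_self]

theorem tendsto_meanGibbsRate_iRDF (hd : Measurable d) (hlam : 0 ≤ lam)
    (hκ : IsOptimalChannel P d lam κ) :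
    Tendsto (fun n => meanGibbsRate lam P.fst (reproLaw P.fst κ) fun x y =>
        truncate n (dbar P d x y)) atTop
      (𝓝 (iRDF P d (expDistortion P d κ)).toReal) := by
  rw [iRDF_eq_mutualInfo hκ]
  rcases hlam.eq_or_lt with rfl | hlam
  · simp [mutualInfo_eq_zero_of_isOptimalChannel_zero hκ, meanGibbsRate, gibbsRate]
  have he : Measurable fun w : (Fin p → ℝ) × Y => ENNReal.ofReal lam * dbar P d w.1 w.2 :=
    (measurable_dbar hd).const_mul _
  obtain ⟨hpos, hlog, hgibbs⟩ := compProd_eq_compProd_gibbsKernel_of_isMinimizer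
    (μ := P.fst) (κ := κ) he (by rw [← lagrangian_eq hd]; exact hκ.1) fun κ' hκ' => by
      rw [← lagrangian_eq hd, ← lagrangian_eq hd]
      exact hκ.2 κ' hκ'
  have hrate := toReal_klDiv_compProd_gibbsKernel he hpos hlog
  rw [← hgibbs] at hrate
  rw [mutualInfo, reproLaw, hrate]
  exact tendsto_meanGibbsRate_truncate (D := fun w => dbar P d w.1 w.2) hlam (measurable_dbar hd)
    hpos hlog

end Optimal

/-! ### The approximating pair of networks -/

lemma measurableEmbedding_append {p q : ℕ} {Y : Set (Fin q → ℝ)} (hY : MeasurableSet Y) :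
    MeasurableEmbedding fun w : (Fin p → ℝ) × Y => Fin.append w.1 (w.2 : Fin q → ℝ) :=
  (Fin.appendHomeomorph p q).measurableEmbedding.comp
    (MeasurableEmbedding.id.prodMap (MeasurableEmbedding.subtype_coe hY))

theorem exists_ridge_transport_and_estimator {p q l : ℕ} {S : Type*} [MeasurableSpace S]
    [StandardBorelSpace S] [Nonempty S] {P : Measure ((Fin p → ℝ) × S)} [IsProbabilityMeasure P]
    {Y : Set (Fin q → ℝ)} (hY : MeasurableSet Y) {d : S × Y → ℝ≥0∞} (hd : Measurable d)
    (PZ : Measure (Fin l → ℝ)) [IsProbabilityMeasure PZ] [NullSingletonClass PZ]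
    {σ : ℝ → ℝ} (hσ : IsSquashing σ) {lam : ℝ} (hlam : 0 ≤ lam)
    {κ : Kernel (Fin p → ℝ) Y} [IsMarkovKernel κ] (hκ : IsOptimalChannel P d lam κ)
    {ε : ℝ} (hε : 0 < ε) :
    ∃ T : (Fin l → ℝ) → Fin q → ℝ, (∀ o, (T · o) ∈ ridge σ (Fin l → ℝ)) ∧
    ∃ G ∈ ridge σ (Fin (p + q) → ℝ),
      levyProkhorovEDist (PZ.map T) ((reproLaw P.fst κ).map Subtype.val) < ENNReal.ofReal ε ∧
      P.fst.prod (reproLaw P.fst κ)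
        {w | ¬ CloseTo ε (G (Fin.append w.1 w.2)) (dbar P d w.1 w.2)} ≤ ENNReal.ofReal ε ∧
      |meanGibbsRate lam P.fst (PZ.map T) (fun x y => G (Fin.append x y)) -
        (iRDF P d (expDistortion P d κ)).toReal| < ε := by
  obtain ⟨G, hG, hclose, hrate⟩ := exists_ridge_estimator hσ (measurableEmbedding_append hY)
    (measurable_dbar hd) (tendsto_meanGibbsRate_iRDF hd hlam hκ) hε (half_pos hε)
  obtain ⟨B, hB⟩ := ridge_bounded hσ G hG
  have hg : Continuous (Function.uncurry fun (x : Fin p → ℝ) (y : Fin q → ℝ) =>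
      G (Fin.append x y)) :=
    (ridge_uniformContinuous hσ G hG).continuous.comp (Fin.continuous_append p q)
  have : IsProbabilityMeasure ((reproLaw P.fst κ).map (Subtype.val : Y → Fin q → ℝ)) :=
    Measure.isProbabilityMeasure_map measurable_subtype_coe.aemeasurable
  obtain ⟨T, hT, hlaw, htransport⟩ := exists_ridge_transport hσ PZ
    ((reproLaw P.fst κ).map (Subtype.val : Y → Fin q → ℝ)) P.fst lam hg (fun x y => hB _)
    (ENNReal.ofReal_pos.2 hε) (half_pos hε)
  rw [meanGibbsRate_map (ν := reproLaw P.fst κ) lam measurable_subtype_coe.aemeasurable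
    hg.measurable] at htransport
  refine ⟨T, hT, G, hG, hlaw, hclose, ?_⟩
  calc _ ≤ _ := abs_sub_le _ _ _
    _ < ε / 2 + ε / 2 := add_lt_add htransport hrate
    _ = ε := add_halves ε

theorem ae_tendsto_empR_of_mem_ridge {Ω : Type*} [MeasurableSpace Ω] {μ : Measure Ω}
    [IsProbabilityMeasure μ] {p q l : ℕ} {PX : Measure (Fin p → ℝ)} [IsFiniteMeasure PX]
    {PZ : Measure (Fin l → ℝ)} [IsProbabilityMeasure PZ] {σ : ℝ → ℝ} (hσ : IsSquashing σ)
    {T : (Fin l → ℝ) → Fin q → ℝ} (hT : ∀ o, (T · o) ∈ ridge σ (Fin l → ℝ))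
    {G : (Fin (p + q) → ℝ) → ℝ} (hG : G ∈ ridge σ (Fin (p + q) → ℝ)) (lam : ℝ)
    {X : ℕ → Ω → Fin p → ℝ} {Z : ℕ → Ω → Fin l → ℝ}
    (hX : ∀ i, HasLaw (X i) PX μ) (hXind : Pairwise fun i j => X i ⟂ᵢ[μ] X j)
    (hZ : ∀ j, HasLaw (Z j) PZ μ) (hZind : Pairwise fun i j => Z i ⟂ᵢ[μ] Z j) :
    ∀ᵐ ω ∂μ, Tendsto (fun nm : ℕ × ℕ =>
        empR lam (fun x y => G (Fin.append x y)) T (X · ω) (Z · ω) nm.1 nm.2) atTop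
      (𝓝 (meanGibbsRate lam PX (PZ.map T) fun x y => G (Fin.append x y))) := by
  obtain ⟨B, hB⟩ := ridge_bounded hσ G hG
  have hTm : Measurable T := measurable_pi_lambda _ fun o =>
    (ridge_uniformContinuous hσ _ (hT o)).continuous.measurable
  have hg : UniformContinuous (Function.uncurry fun (x : Fin p → ℝ) (y : Fin q → ℝ) =>
      G (Fin.append x y)) :=
    (ridge_uniformContinuous hσ G hG).comp (Fin.appendIsometry p q).isometry.uniformContinuous
  exact ae_tendsto_empR hTm lam hg (fun x y => hB _) hX hXind hZ hZind

end IndirectRD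

open IndirectRD

theorem mainTheorem2 {p q l : ℕ}
    {S : Type*} [MeasurableSpace S] [StandardBorelSpace S] [Nonempty S]
    (P : Measure ((Fin p → ℝ) × S)) [IsProbabilityMeasure P]
    (Y : Set (Fin q → ℝ)) (hY : MeasurableSet Y)
    (d : S × Y → ℝ≥0∞) (hd : Measurable d)
    (PZ : Measure (Fin l → ℝ)) [IsProbabilityMeasure PZ] [NullSingletonClass PZ]
    (σ : ℝ → ℝ) (hσ : IndirectRD.IsSquashing σ)
    (lam : ℝ) (hlam : 0 ≤ lam)
    (κ : Kernel (Fin p → ℝ) Y) [IsMarkovKernel κ]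
    (hκ : IndirectRD.IsOptimalChannel P d lam κ)
    (ε : ℝ) (hε : 0 < ε) :
    IndirectRD.iRDF P d (IndirectRD.expDistortion P d κ) ≠ ∞ ∧
    ∃ k₀ : ℕ, ∀ k ≥ k₀,
      ∃ Θ Θ' : Set (EuclideanSpace ℝ (Fin k)), IsCompact Θ ∧ IsCompact Θ' ∧
      ∃ θ ∈ Θ, ∃ θ' ∈ Θ',
        -- the push-forward of the base law approximates the optimal reproduction law
        levyProkhorovEDist (PZ.map (IndirectRD.reproNet (l := l) (q := q) σ θ))
            ((IndirectRD.reproLaw P.fst κ).map (Subtype.val : Y → (Fin q → ℝ)))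
          ≤ ENNReal.ofReal ε ∧
        -- the distortion estimator approximates the reduced distortion in measure
        (P.fst.prod (IndirectRD.reproLaw P.fst κ))
            {w | ¬ IndirectRD.CloseTo ε (IndirectRD.distNet σ θ' w.1 (w.2 : Fin q → ℝ))
              (IndirectRD.dbar P d w.1 w.2)}
          ≤ ENNReal.ofReal ε ∧
        -- strong consistency of the empirical estimate
        ∀ (Ω : Type*) [MeasurableSpace Ω] (μ : Measure Ω) [IsProbabilityMeasure μ]
          (XS : ℕ → Ω → (Fin p → ℝ) × S) (Z : ℕ → Ω → (Fin l → ℝ)),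
          (∀ i, Measurable (XS i)) → (∀ i, μ.map (XS i) = P) → iIndepFun XS μ →
          (∀ j, Measurable (Z j)) → (∀ j, μ.map (Z j) = PZ) → iIndepFun Z μ →
          ∀ᵐ ω ∂μ, ∃ N M : ℕ, ∀ n ≥ N, ∀ m ≥ M,
            |IndirectRD.empR lam (IndirectRD.distNet (p := p) (q := q) σ θ')
                (IndirectRD.reproNet (l := l) (q := q) σ θ)
                (fun i => (XS i ω).1) (fun j => Z j ω) n m
              - (IndirectRD.iRDF P d (IndirectRD.expDistortion P d κ)).toReal| ≤ ε := by
  obtain ⟨T, hT, G, hG, hlaw, hclose, hrate⟩ :=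
    exists_ridge_transport_and_estimator hY hd PZ hσ hlam hκ hε
  refine ⟨iRDF_ne_top hκ, eventually_atTop.1 ?_⟩
  filter_upwards [eventually_exists_net_eq hT,
    eventually_exists_net_eq (b := 1) (T := fun v _ => G v) fun _ => hG] with k ⟨θ, hθ⟩ ⟨θ', hθ'⟩
  have hreproNet : reproNet σ θ = T := hθ
  have hdistNet : distNet σ θ' = fun (x : Fin p → ℝ) (y : Fin q → ℝ) => G (Fin.append x y) := by
    ext x y
    rw [distNet, hθ']
  refine ⟨{θ}, {θ'}, isCompact_singleton, isCompact_singleton, θ, rfl, θ', rfl, ?_⟩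
  rw [hreproNet, hdistNet]
  refine ⟨hlaw.le, hclose, fun Ω _ μ _ XS Z hXS hP hXSind hZ hPZ hZind => ?_⟩
  have hX : ∀ i, HasLaw (Prod.fst ∘ XS i) P.fst μ := fun i =>
    HasLaw.comp ⟨measurable_fst.aemeasurable, rfl⟩ ⟨(hXS i).aemeasurable, hP i⟩
  filter_upwards [ae_tendsto_empR_of_mem_ridge hσ hT hG lam hX
    (fun i j hij => (hXSind.indepFun hij).comp measurable_fst measurable_fst)
    (fun j => ⟨(hZ j).aemeasurable, hPZ j⟩) fun i j hij => hZind.indepFun hij] with ω hω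
  obtain ⟨⟨N, M⟩, hNM⟩ := eventually_atTop.1
    ((hω.sub_const _).abs.eventually_le_const hrate)
  exact ⟨N, M, fun n hn m hm => hNM (n, m) ⟨hn, hm⟩⟩
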